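/- For each $n\ge 1$ let $A_n=(a^{(n)}_{ij})_{1\le i,j\le n}$ be a random matrix with real entries such that the family $\{a^{(n)}_{ii}\}_{1\le i\le n}\cup\{(a^{(n)}_{ij},a^{(n)}_{ji})\}_{1\le i<j\le n}$ is independent, $\mathbf E[a^{(n)}_{ij}]=0$ and $\mathbf E[(a^{(n)}_{ij})^2]=1$ for all $i,j$, $\mathbf E[a^{(n)}_{ij}a^{(n)}_{ji}]=\rho^{(n)}_{|i-j|}$ for $i\ne j$, and for every $p\in\mathbb N$ the moments $\mathbf E|a^{(n)}_{ij}|^p$ are bounded uniformly in $n,i,j$ (generalised elliptic matrices). The numbers $\rho^{(n)}_0$, which play no role for the matrices, are any bounded sequence of reals. (The case where $a_{ij}$ and $\rho_i$ do not depend on $n$ is included.) Let $NC_2(2k)$ be the set of non-crossing pair partitions of $\{1,\dots,2k\}$, and consider the following condition: for all $k$, all $\epsilon_1,\dots,\epsilon_{2k}\in\{1,*\}$ and all $\pi\in NC_2(2k)$, $$\lim_{n\to\infty}\frac1{n^{k+1}}\sum_{1\le i_1,\dots,i_{2k}\le n}\ \prod_{(r,s)\in\pi}\bigl(\rho^{(n)}_{|i_r-i_s|}\bigr)^{\delta_{\epsilon_r\epsilon_s}}\,\delta_{i_ri_{s+1}}\,\delta_{i_si_{r+1}}\quad\text{exists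 and is finite},\tag{C}$$ where indices are cyclic ($i_{2k+1}=i_1$). A $*$-probability space is a unital complex $*$-algebra $\mathcal A$ with a unital positive linear functional $\varphi$. The sequence $\overline A_n:=A_n/\sqrt n$ converges in $*$-distribution to $a\in\mathcal A$ if $\frac1n\mathbf E\operatorname{Tr}(\overline A_n^{\epsilon_1}\cdots\overline A_n^{\epsilon_p})\to\varphi(a^{\epsilon_1}\cdots a^{\epsilon_p})$ for all $p$ and all $\epsilon_1,\dots,\epsilon_p\in\{1,*\}$. A self-adjoint $s\in\mathcal A$ is semicircular if $\varphi(s^p)=\frac1{2\pi}\int_{-2}^2t^p\sqrt{4-t^2}\,dt$ for all $p$; elements $s_1,s_2$ are free if $\varphi(p_1(s_{i(1)})\cdots p_m(s_{i(m)}))=0$ for all $m\ge1$, all indices with $i(j)\ne i(j+1)$ for $1\le j<m$, and all polynomials $p_j$ with $\varphi(p_j(s_{i(j)}))=0$; and, for $-1\le\rho\le1$, $e$ is elliptic with parameter $\rho$ if $e=\sqrt{\frac{1+\rho}2}\,s_1+\mathrm i\sqrt{\frac{1-\rho}2}\,s_2$ with $s_1,s_2$ free semicircular elements. 1. If (C)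 holds, then $\overline A_n$ converges in $*$-distribution to some element of some $*$-probability space. 2. If $\rho^{(n)}_i=\rho$ for all $n$ and all $i\ge1$, then (C) holds and the limit is elliptic with parameter $\rho$: there is an elliptic element with parameter $\rho$ in some $*$-probability space to which $\overline A_n$ converges in $*$-distribution, and $\overline A_n$ converges in $*$-distribution to every elliptic element with parameter $\rho$ in any $*$-probability space. -/

import Mathlib

open MeasureTheory ProbabilityTheory Filter Topology

noncomputable section

namespace EllipticMatrices

/-! ## Non-commutative probability spaces -/

section NCP

variable {A : Type*} [Ring A] [StarRing A] [Algebra ℂ A]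

/-- A state on a unital complex `*`-algebra: a unital positive linear functional. A unital complex
`*`-algebra with a state is a (non-commutative) `*`-probability space. -/
structure IsState (φ : A →ₗ[ℂ] ℂ) : Prop where
  map_one : φ 1 = 1
  re_nonneg : ∀ x : A, 0 ≤ (φ (star x * x)).re
  im_eq_zero : ∀ x : A, (φ (star x * x)).im = 0

/-- A standard semicircular element. -/
structure IsSemicircular (φ : A →ₗ[ℂ] ℂ) (s : A) : Prop where
  selfAdjoint : star s = s
  moment : ∀ p : ℕ,
    φ (s ^ p) = (((1 / (2 * Real.pi)) * ∫ t in (-2 : ℝ)..2, t ^ p * √(4 - t ^ 2) : ℝ) : ℂ)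

/-- Freeness of a family of elements: an alternating product of at least one centred polynomials
in the elements is centred. -/
def IsFree (φ : A →ₗ[ℂ] ℂ) {ι : Type*} (s : ι → A) : Prop :=
  ∀ (k : ℕ) (i : Fin (k + 1) → ι) (p : Fin (k + 1) → Polynomial ℂ),
    (∀ j : Fin k, i j.castSucc ≠ i j.succ) →
    (∀ j, φ (Polynomial.aeval (s (i j)) (p j)) = 0) →
    φ (List.ofFn fun j => Polynomial.aeval (s (i j)) (p j)).prod = 0

/-- An elliptic element with parameter `r ∈ [-1, 1]`. -/
def IsElliptic (φ : A →ₗ[ℂ] ℂ) (r : ℝ) (e : A) : Prop :=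
  -1 ≤ r ∧ r ≤ 1 ∧
  ∃ s₁ s₂ : A, IsSemicircular φ s₁ ∧ IsSemicircular φ s₂ ∧ IsFree φ ![s₁, s₂] ∧
    e = ((√((1 + r) / 2) : ℝ) : ℂ) • s₁ + (Complex.I * ((√((1 - r) / 2) : ℝ) : ℂ)) • s₂

end NCP

/-- The word `x ^ ε₁ ⋯ x ^ εₚ`, where the exponent `false` stands for `1` and `true` for `*`. -/
def starWord {A : Type*} [Monoid A] [Star A] (x : A) {p : ℕ} (ε : Fin p → Bool) : A :=
  (List.ofFn fun j => if ε j then star x else x).prod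

/-! ## Random matrices -/

/-- The tracial state `x ↦ n⁻¹ E Tr x` on `n × n` random matrices. -/
def expTrace {n : ℕ} {Ω : Type*} [MeasurableSpace Ω] (P : Measure Ω)
    (X : Ω → Matrix (Fin n) (Fin n) ℂ) : ℂ :=
  (1 / (n : ℂ)) * ∫ ω, (X ω).trace ∂P

/-- Convergence in `*`-distribution of a sequence of random matrices to an element `x` of a
`*`-probability space. The words in `X n` are formed in the `*`-algebra of matrix-valued functions
on `Ω n`, with pointwise product and pointwise conjugate transpose. -/
def ConvergesInStarDist {Ω : ℕ → Type*} [∀ n, MeasurableSpace (Ω n)] (P : ∀ n, Measure (Ω n))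
    (X : ∀ n, Ω n → Matrix (Fin n) (Fin n) ℂ)
    {A : Type*} [Ring A] [StarRing A] [Algebra ℂ A] (φ : A →ₗ[ℂ] ℂ) (x : A) : Prop :=
  ∀ (p : ℕ) (ε : Fin p → Bool),
    Tendsto (fun n => expTrace (P n) (starWord (X n) ε)) atTop (𝓝 (φ (starWord x ε)))

/-- The real random matrix `n^{-1/2} a`, regarded as a complex one. -/
def scaled {n : ℕ} {Ω : Type*} (a : Ω → Matrix (Fin n) (Fin n) ℝ) :
    Ω → Matrix (Fin n) (Fin n) ℂ :=
  fun ω => (((√(n : ℝ))⁻¹ : ℝ) : ℂ) • (a ω).map Complex.ofReal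

/-- The distance `|i - j|` of two indices. -/
def idxDist {n : ℕ} (i j : Fin n) : ℕ := ((i : ℤ) - (j : ℤ)).natAbs

/-- A sequence of generalised elliptic random matrices `a n = (a n)ᵢⱼ` of size `n`, with
correlations `ρ n |i - j|`. The entries and the correlations may change with `n`; the moments are
bounded uniformly in all the indices and in `n`. As the diagonal entries are not concerned by
`ρ`, the number `ρ n 0` is arbitrary, up to boundedness in `n`. -/
structure IsGeneralisedElliptic {Ω : ℕ → Type*} [∀ n, MeasurableSpace (Ω n)]
    (P : ∀ n, Measure (Ω n)) (a : ∀ n, Ω n → Matrix (Fin n) (Fin n) ℝ) (ρ : ℕ → ℕ → ℝ) :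
    Prop where
  measurable : ∀ n i j, Measurable fun ω => a n ω i j
  /-- independence of the family of all the `aᵢᵢ` and all the pairs `(aᵢⱼ, aⱼᵢ)`, `i < j` -/
  indep : ∀ n, iIndepFun
    (fun (q : {q : Fin n × Fin n // q.1 ≤ q.2}) (ω : Ω n) =>
      ((a n ω q.1.1 q.1.2, a n ω q.1.2 q.1.1) : ℝ × ℝ)) (P n)
  moments_bounded : ∀ p : ℕ, ∃ C : ℝ, ∀ n i j,
    Integrable (fun ω => |a n ω i j| ^ p) (P n) ∧ ∫ ω, |a n ω i j| ^ p ∂(P n) ≤ C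
  mean_zero : ∀ n i j, ∫ ω, a n ω i j ∂(P n) = 0
  variance_one : ∀ n i j, ∫ ω, (a n ω i j) ^ 2 ∂(P n) = 1
  correlation : ∀ n i j, i ≠ j → ∫ ω, a n ω i j * a n ω j i ∂(P n) = ρ n (idxDist i j)
  bounded_zero : ∃ C : ℝ, ∀ n, |ρ n 0| ≤ C

/-! ## The limit condition on the correlations -/

/-- Non-crossing pair partitions of `m` points, given as permutations: `π r = s` and `π s = r`
when `{r, s}` is a block. -/
structure IsNCPairing {m : ℕ} (π : Equiv.Perm (Fin m)) : Prop where
  involutive : ∀ r, π (π r) = r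
  fixedPointFree : ∀ r, π r ≠ r
  nonCrossing : ∀ r s, ¬ (r < s ∧ s < π r ∧ π r < π s)

/-- The normalised sum
`n^{-(k+1)} ∑_{i₁, …, i₂ₖ ≤ n} ∏_{(r,s) ∈ π} ρ_{|i_r - i_s|} ^ δ(ε_r, ε_s) δ(i_r, i_{s+1}) δ(i_s, i_{r+1})`
with `r + 1` understood cyclically (this is `finRotate`); the product runs over `r < s = π r`. -/
def corrSum (ρ : ℕ → ℝ) (n k : ℕ) (ε : Fin (2 * k) → Bool) (π : Equiv.Perm (Fin (2 * k))) : ℝ :=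
  (1 / (n : ℝ) ^ (k + 1)) *
    ∑ i : Fin (2 * k) → Fin n, ∏ r : Fin (2 * k) with r < π r,
      (ρ (idxDist (i r) (i (π r))) ^ (if ε r = ε (π r) then 1 else 0) *
        (if i r = i (finRotate (2 * k) (π r)) then 1 else 0) *
        (if i (π r) = i (finRotate (2 * k) r) then 1 else 0))

/-- The limit condition: all the normalised sums over non-crossing pairings have a finite limit. -/
def LimitCondition (ρ : ℕ → ℕ → ℝ) : Prop :=
  ∀ (k : ℕ) (ε : Fin (2 * k) → Bool) (π : Equiv.Perm (Fin (2 * k))), IsNCPairing π →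
    ∃ L : ℝ, Tendsto (fun n => corrSum (ρ n) n k ε π) atTop (𝓝 L)

end EllipticMatrices

end

noncomputable section

namespace EllipticMatrices

/-! ## Closed walks which traverse every edge at least twice -/

section Walks

/-! The normalised trace of a word of length `p` is a sum over closed walks of length `p` on `n`
vertices. By independence and centring, a walk contributes nothing if some undirected edge (loops
included) is used only once; the other expectations are bounded uniformly in `n`. There are `O(n ^
v)` walks with at most `v` vertices, so after normalisation by `n ^ (-1 - p / 2)` only walks with at
least `p / 2 + 1` vertices matter. Such a walk goes around a tree: it has exactly `p / 2 + 1`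
vertices, crosses each edge once in each direction, and the two crossing times form the blocks of a
unique non-crossing pairing (`exists_isTreePairing`, `IsTreePairing.eq`). Its expectation is the
product of the covariances over the blocks (`walkExp_eq_prod_corr`), which is the summand of
`corrSum`. Hence odd moments vanish in the limit, and even moments differ from the sum of `corrSum`
over non-crossing pairings by a null sequence (`tendsto_expTrace_sub`).

Under the limit condition all moments therefore converge. The limits define a functional on the free
`*`-algebra with one generator, and its positivity is inherited from the random matrices
(`exists_limit_of_moments`).

For a constant correlation `r`, every loopless labelling compatible with a pairing has the same
summand, and there are `n ^ (k + 1)` compatible labellings (`card_compatible`). The limit moment is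
thus the sum over non-crossing pairings of the products of block weights, `r` for equal letters and
`1` for different ones. Reading the word letter by letter turns this sum into the stack recursion
`wickSum` (`sum_ncPairings`). The moments of an elliptic element obey the same recursion: in the
Wick products of two free semicirculars, left multiplication by a linear combination of them is
creation plus annihilation, and contracting two letters produces the same weight
(`apply_prod_eq_wickSum`). Existence of elliptic elements comes from the field operators on the full
Fock space. Both arguments rest on Chebyshev polynomials, which are centred in positive degree for
the semicircle law and satisfy the recurrence of creation and annihilation. -/

/-- A non-crossing pairing of `{0, …, p - 1}`, given by a function on the natural numbers. -/
structure IsNatNCPairing (p : ℕ) (f : ℕ → ℕ) : Prop where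
  lt : ∀ t < p, f t < p
  involutive : ∀ t < p, f (f t) = t
  ne : ∀ t < p, f t ≠ t
  nonCrossing : ∀ r s, r < s → s < f r → f r < f s → f s < p → False

/-- Insertion of the block `{j, j + 1}` into a pairing. -/
def insertPair (j : ℕ) (f : ℕ → ℕ) (t : ℕ) : ℕ :=
  if t = j then j + 1 else if t = j + 1 then j else
    if f (if t < j then t else t - 2) < j then f (if t < j then t else t - 2)
    else f (if t < j then t else t - 2) + 2

lemma insertPair_left (j : ℕ) (f : ℕ → ℕ) : insertPair j f j = j + 1 := by simp [insertPair]

lemma insertPair_right (j : ℕ) (f : ℕ → ℕ) : insertPair j f (j + 1) = j := by simp [insertPair]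

/-- The increasing enumeration of the numbers different from `j` and `j + 1`. -/
def skipPair (j t : ℕ) : ℕ := if t < j then t else t + 2

lemma insertPair_skipPair (j : ℕ) (f : ℕ → ℕ) (t : ℕ) :
    insertPair j f (skipPair j t) = skipPair j (f t) := by
  unfold insertPair skipPair
  by_cases h : t < j
  · have h1 : t ≠ j := by omega
    have h2 : t ≠ j + 1 := by omega
    simp [h, h1, h2]
  · have h1 : t + 2 ≠ j := by omega
    have h2 : t + 2 ≠ j + 1 := by omega
    have h3 : ¬ (t + 2 < j) := by omega
    simp only [h, h1, h2, h3, if_false, Nat.add_sub_cancel]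

lemma skipPair_lt_skipPair {j s t : ℕ} : skipPair j s < skipPair j t ↔ s < t := by
  unfold skipPair; split_ifs <;> omega

lemma skipPair_injective (j : ℕ) : Function.Injective (skipPair j) := by
  intro s t; unfold skipPair; split_ifs <;> omega

lemma skipPair_ne_left (j t : ℕ) : skipPair j t ≠ j := by
  unfold skipPair; split_ifs <;> omega

lemma skipPair_ne_right (j t : ℕ) : skipPair j t ≠ j + 1 := by
  unfold skipPair; split_ifs <;> omega

lemma skipPair_lt {j p t : ℕ} (hj : j ≤ p) : skipPair j t < p + 2 ↔ t < p := by
  unfold skipPair; split_ifs <;> omega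

lemma eq_skipPair (j s : ℕ) : s = j ∨ s = j + 1 ∨ ∃ t, s = skipPair j t := by
  by_cases h : s < j
  · exact Or.inr (Or.inr ⟨s, by simp [skipPair, h]⟩)
  · by_cases h1 : s = j
    · exact Or.inl h1
    · by_cases h2 : s = j + 1
      · exact Or.inr (Or.inl h2)
      · refine Or.inr (Or.inr ⟨s - 2, ?_⟩)
        unfold skipPair; split_ifs <;> omega

/-- The new block joins neighbours, so nothing lies strictly between its ends and it crosses no
other block; `skipPair` is increasing, so the old blocks keep their relative order. -/
lemma IsNatNCPairing.insertPair {p : ℕ} {f : ℕ → ℕ} (hf : IsNatNCPairing p f) {j : ℕ}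
    (hj : j ≤ p) : IsNatNCPairing (p + 2) (insertPair j f) where
  lt t ht := by
    obtain rfl | rfl | ⟨t, rfl⟩ := eq_skipPair j t
    · rw [insertPair_left]; omega
    · rw [insertPair_right]; omega
    · rw [insertPair_skipPair, skipPair_lt hj]
      exact hf.lt _ ((skipPair_lt hj).1 ht)
  involutive t ht := by
    obtain rfl | rfl | ⟨t, rfl⟩ := eq_skipPair j t
    · rw [insertPair_left, insertPair_right]
    · rw [insertPair_right, insertPair_left]
    · rw [insertPair_skipPair, insertPair_skipPair, hf.involutive _ ((skipPair_lt hj).1 ht)]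
  ne t ht := by
    obtain rfl | rfl | ⟨t, rfl⟩ := eq_skipPair j t
    · rw [insertPair_left]; omega
    · rw [insertPair_right]; omega
    · rw [insertPair_skipPair]
      exact fun h => hf.ne _ ((skipPair_lt hj).1 ht) (skipPair_injective j h)
  nonCrossing r s h1 h2 h3 h4 := by
    obtain rfl | rfl | ⟨r, rfl⟩ := eq_skipPair j r
    · rw [insertPair_left] at h2; omega
    · rw [insertPair_right] at h2; omega
    · rw [insertPair_skipPair] at h2 h3
      obtain rfl | rfl | ⟨s, rfl⟩ := eq_skipPair j s
      · rw [insertPair_left] at h3; omega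
      · rw [insertPair_right] at h3; omega
      · rw [insertPair_skipPair] at h3 h4
        rw [skipPair_lt_skipPair] at h1 h2 h3
        exact hf.nonCrossing r s h1 h2 h3 ((skipPair_lt hj).1 h4)

variable {V : Type*}

/-- The edge used by a walk at time `t`. -/
def walkEdge (w : ℕ → V) (t : ℕ) : Sym2 V := s(w t, w (t + 1))

/-- The block structure of a closed walk on a tree which uses every edge exactly twice. -/
structure IsTreeWalk (p : ℕ) (w : ℕ → V) (f : ℕ → ℕ) : Prop where
  pairing : IsNatNCPairing p f
  left : ∀ t < p, w (f t) = w (t + 1)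
  right : ∀ t < p, w (f t + 1) = w t
  edge : ∀ s < p, ∀ t < p, walkEdge w s = walkEdge w t → s = t ∨ s = f t
  loopless : ∀ t < p, w t ≠ w (t + 1)

/-- A closed walk visiting many vertices has a vertex, other than its origin, which is visited
only once. -/
lemma exists_visited_once [DecidableEq V] {p : ℕ} (w : ℕ → V) (hw : w p = w 0) (hp : 1 ≤ p)
    (hV : p + 2 ≤ 2 * ((Finset.range (p + 1)).image w).card) :
    ∃ j, 1 ≤ j ∧ j < p ∧ ∀ s ≤ p, w s = w j → s = j := by
  by_contra! hcon
  have himage : (Finset.range (p + 1)).image w = (Finset.range p).image w := by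
    rw [Finset.range_add_one, Finset.image_insert]
    refine Finset.insert_eq_of_mem ?_
    rw [hw]
    exact Finset.mem_image_of_mem _ (Finset.mem_range.2 hp)
  rw [himage] at hV
  set I := (Finset.range p).image w with hI
  have h0 : w 0 ∈ I := Finset.mem_image_of_mem _ (Finset.mem_range.2 hp)
  have hcard := Finset.card_eq_sum_card_image w (Finset.range p)
  rw [← hI, Finset.card_range, ← Finset.sum_erase_add _ _ h0] at hcard
  -- With time `p` dropped as a repetition of the origin, every other vertex would take two of the
  -- `p` times and the origin one, so `2 * (card - 1) + 1 ≤ p`, against `hV`.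
  have hbig : ∀ v ∈ I.erase (w 0), 2 ≤ ((Finset.range p).filter fun x => w x = v).card := by
    intro v hv
    obtain ⟨hv0, hv⟩ := Finset.mem_erase.1 hv
    obtain ⟨j, hj, rfl⟩ := Finset.mem_image.1 hv
    have hj := Finset.mem_range.1 hj
    have hj0 : j ≠ 0 := by rintro rfl; exact hv0 rfl
    obtain ⟨s, hs, hsj, hne⟩ := hcon j (by omega) hj
    have hsp : s ≠ p := by rintro rfl; exact hv0 (by rw [← hsj, hw])
    refine Finset.one_lt_card.2 ⟨j, ?_, s, ?_, fun h => hne h.symm⟩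
    · simp [hj]
    · simp only [Finset.mem_filter, Finset.mem_range]; exact ⟨by omega, hsj⟩
  have hone : 1 ≤ ((Finset.range p).filter fun x => w x = w 0).card :=
    Finset.card_pos.2 ⟨0, by simp; omega⟩
  have hsum := Finset.sum_le_sum hbig
  rw [Finset.sum_const, smul_eq_mul, Finset.card_erase_of_mem h0] at hsum
  omega

/-- A leaf is pruned at each step of the induction. A vertex visited once, at time `j + 1`, meets
only the edges of times `j` and `j + 1`; as no edge is used once, these coincide and the walk
backtracks. Deleting the excursion removes two steps and at most one vertex, so the inequality `hV`
survives, and the block `{j, j + 1}` is put back into the pairing of the shorter walk. -/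
lemma exists_isTreeWalk [DecidableEq V] (p : ℕ) (w : ℕ → V) (hw : w p = w 0)
    (hedge : ∀ t < p, ∃ s < p, s ≠ t ∧ walkEdge w s = walkEdge w t)
    (hV : p + 2 ≤ 2 * ((Finset.range (p + 1)).image w).card) :
    Even p ∧ 2 * ((Finset.range (p + 1)).image w).card = p + 2 ∧ ∃ f, IsTreeWalk p w f := by
  induction p using Nat.strong_induction_on generalizing w with
  | _ p ih =>
  obtain rfl | hp := Nat.eq_zero_or_pos p
  · refine ⟨by simp, by simp, id, ⟨⟨?_, ?_, ?_, ?_⟩, ?_, ?_, ?_, ?_⟩⟩ <;> intros <;> omega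
  obtain ⟨j, hj1, hjp, hj⟩ := exists_visited_once w hw hp hV
  obtain ⟨j, rfl⟩ : ∃ i, j = i + 1 := ⟨j - 1, by omega⟩
  obtain ⟨q, rfl⟩ : ∃ q, p = q + 2 := ⟨p - 2, by omega⟩
  have hne1 : w j ≠ w (j + 1) := fun h => by have := hj j (by omega) h; omega
  have hne2 : w (j + 2) ≠ w (j + 1) := fun h => by have := hj (j + 2) (by omega) h; omega
  -- the only two edges containing the vertex
  have hmem : ∀ s < q + 2, w (j + 1) ∈ walkEdge w s → s = j ∨ s = j + 1 := by
    intro s hs h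
    rw [walkEdge, Sym2.mem_iff] at h
    rcases h with h | h
    · right; exact hj s (by omega) h.symm
    · left; have := hj (s + 1) (by omega) h.symm; omega
  have hret : w (j + 2) = w j := by
    obtain ⟨s, hs, hsj, h⟩ := hedge j (by omega)
    have hm : w (j + 1) ∈ walkEdge w s := by rw [h, walkEdge]; exact Sym2.mem_mk_right _ _
    obtain rfl | rfl := hmem s hs hm
    · exact absurd rfl hsj
    · rw [walkEdge, walkEdge, Sym2.eq_iff] at h
      rcases h with ⟨h, -⟩ | ⟨-, h⟩
      · exact absurd h.symm hne1
      · exact h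
  -- Since `w (j + 2) = w j`, deleting the times `j + 1, j + 2` or the times `j, j + 1` gives the
  -- same walk. The first form suits the ends of steps, the second their starting points.
  set w' : ℕ → V := fun t => w (skipPair (j + 1) t) with hw'
  have hskip : ∀ t, w' t = w (skipPair j t) := by
    intro t
    simp only [hw', skipPair]
    by_cases h1 : t < j
    · rw [if_pos (by omega), if_pos h1]
    · by_cases h2 : t = j
      · subst h2; simp [hret]
      · rw [if_neg (by omega), if_neg h1]
  have hskip' : ∀ t, w' (t + 1) = w (skipPair j t + 1) := by
    intro t
    simp only [hw', skipPair]
    by_cases h1 : t < j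
    · rw [if_pos (by omega), if_pos h1]
    · rw [if_neg (by omega), if_neg h1]
  have hedge' : ∀ t, walkEdge w' t = walkEdge w (skipPair j t) := by
    intro t; rw [walkEdge, walkEdge, hskip, hskip']
  have hw0 : w' q = w' 0 := by
    simp only [hskip]
    have h0 : w (skipPair j 0) = w 0 := by
      by_cases h : 0 < j
      · simp [skipPair, h]
      · obtain rfl : j = 0 := by omega
        simpa [skipPair] using hret
    rw [h0, ← hw]
    by_cases h : q < j
    · have : q + 1 = j := by omega
      omega
    · simp [skipPair, h]
  have hnotmem : ∀ t < q, w (j + 1) ∉ walkEdge w (skipPair j t) := by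
    intro t ht h
    rcases hmem _ ((skipPair_lt (by omega)).2 ht) h with h | h
    · exact skipPair_ne_left _ _ h
    · exact skipPair_ne_right _ _ h
  have hm1 : w (j + 1) ∈ walkEdge w j := Sym2.mem_mk_right _ _
  have hm2 : w (j + 1) ∈ walkEdge w (j + 1) := Sym2.mem_mk_left _ _
  have hmult : ∀ t < q, ∃ s < q, s ≠ t ∧ walkEdge w' s = walkEdge w' t := by
    intro t ht
    obtain ⟨s, hs, hne, he⟩ := hedge (skipPair j t) ((skipPair_lt (by omega)).2 ht)
    obtain rfl | rfl | ⟨s, rfl⟩ := eq_skipPair j s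
    · exact absurd (he ▸ hm1) (hnotmem t ht)
    · exact absurd (he ▸ hm2) (hnotmem t ht)
    · refine ⟨s, (skipPair_lt (by omega)).1 hs, fun h => hne (by rw [h]), ?_⟩
      rw [hedge', hedge', he]
  have hcard : ((Finset.range (q + 2 + 1)).image w).card
      ≤ ((Finset.range (q + 1)).image w').card + 1 := by
    refine (Finset.card_le_card (t := insert (w (j + 1)) ((Finset.range (q + 1)).image w')) ?_).trans
      (Finset.card_insert_le _ _)
    intro v hv
    obtain ⟨t, ht, rfl⟩ := Finset.mem_image.1 hv
    have ht := Finset.mem_range.1 ht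
    rw [Finset.mem_insert, Finset.mem_image]
    obtain rfl | rfl | ⟨t, rfl⟩ := eq_skipPair (j + 1) t
    · exact Or.inl rfl
    · right
      refine ⟨j, by simp; omega, ?_⟩
      simp [hw', skipPair, hret]
    · right
      refine ⟨t, ?_, rfl⟩
      rw [Finset.mem_range]
      exact (skipPair_lt (j := j + 1) (by omega)).1 ht
  obtain ⟨heven, hcard', f, hf⟩ := ih q (by omega) w' hw0 hmult (by omega)
  refine ⟨by simpa [Nat.even_add] using heven, by omega, insertPair j f,
    hf.pairing.insertPair (by omega), ?_, ?_, ?_, ?_⟩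
  · intro t ht
    obtain rfl | rfl | ⟨t, rfl⟩ := eq_skipPair j t
    · rw [insertPair_left]
    · rw [insertPair_right, hret]
    · rw [insertPair_skipPair, ← hskip, ← hskip', hf.left t ((skipPair_lt (by omega)).1 ht)]
  · intro t ht
    obtain rfl | rfl | ⟨t, rfl⟩ := eq_skipPair j t
    · rw [insertPair_left, hret]
    · rw [insertPair_right]
    · rw [insertPair_skipPair, ← hskip, ← hskip', hf.right t ((skipPair_lt (by omega)).1 ht)]
  · intro s hs t ht h
    obtain rfl | rfl | ⟨t, rfl⟩ := eq_skipPair j t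
    · rw [insertPair_left]
      exact hmem s hs (h ▸ hm1)
    · rw [insertPair_right]
      exact (hmem s hs (h ▸ hm2)).symm
    · have htq := (skipPair_lt (by omega)).1 ht
      obtain rfl | rfl | ⟨s, rfl⟩ := eq_skipPair j s
      · exact absurd (h ▸ hm1) (hnotmem t htq)
      · exact absurd (h ▸ hm2) (hnotmem t htq)
      · rw [← hedge', ← hedge'] at h
        rw [insertPair_skipPair]
        exact (hf.edge s ((skipPair_lt (by omega)).1 hs) t htq h).imp (congrArg _) (congrArg _)
  · intro t ht
    obtain rfl | rfl | ⟨t, rfl⟩ := eq_skipPair j t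
    · exact hne1
    · exact hne2.symm
    · rw [← hskip, ← hskip']
      exact hf.loopless t ((skipPair_lt (by omega)).1 ht)

end Walks

/-! ## Labellings compatible with a pairing -/

section Labellings

variable {V : Type*} {p : ℕ}

lemma val_finRotate (r : Fin p) : (finRotate p r : ℕ) = (r + 1) % p := by
  obtain _ | p := p
  · exact r.elim0
  · by_cases h : r = Fin.last p
    · subst h; simp
    · rw [coe_finRotate_of_ne_last h, Nat.mod_eq_of_lt]
      have := Fin.val_lt_last h
      omega

lemma ofNat_succ_eq_finRotate [NeZero p] (r : Fin p) : Fin.ofNat p (r + 1) = finRotate p r := by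
  ext; rw [val_finRotate, Fin.val_ofNat]

lemma ofNat_val_eq [NeZero p] (r : Fin p) : Fin.ofNat p r = r := by
  ext; rw [Fin.val_ofNat, Nat.mod_eq_of_lt r.2]

/-- The edge used at time `r` by the closed walk with vertices `i`. -/
def cycEdge (i : Fin p → V) (r : Fin p) : Sym2 V := s(i r, i (finRotate p r))

/-- The vertices are identified as prescribed by the pairing `π`. -/
def Compatible (π : Equiv.Perm (Fin p)) (i : Fin p → V) : Prop :=
  ∀ r, i (finRotate p (π r)) = i r

/-- A pairing whose blocks are exactly the sets of times at which a given edge is used. -/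
structure IsTreePairing (i : Fin p → V) (π : Equiv.Perm (Fin p)) : Prop where
  pairing : IsNCPairing π
  compatible : Compatible π i
  edge : ∀ s t, cycEdge i s = cycEdge i t → s = t ∨ s = π t
  loopless : ∀ r, i r ≠ i (finRotate p r)

lemma Compatible.apply_pairing {π : Equiv.Perm (Fin p)} {i : Fin p → V} (h : Compatible π i)
    (hπ : IsNCPairing π) (r : Fin p) : i (π r) = i (finRotate p r) := by
  rw [← h (π r), hπ.involutive]

lemma Compatible.cycEdge_eq {π : Equiv.Perm (Fin p)} {i : Fin p → V} (h : Compatible π i)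
    (hπ : IsNCPairing π) (r : Fin p) : cycEdge i (π r) = cycEdge i r := by
  rw [cycEdge, cycEdge, h r, h.apply_pairing hπ, Sym2.eq_swap]

lemma Compatible.exists_edge {π : Equiv.Perm (Fin p)} {i : Fin p → V} (h : Compatible π i)
    (hπ : IsNCPairing π) (r : Fin p) : ∃ s, s ≠ r ∧ cycEdge i s = cycEdge i r :=
  ⟨π r, hπ.fixedPointFree r, h.cycEdge_eq hπ r⟩

/-- The cyclic labelling is unrolled to a periodic walk on `ℕ`, where the pruning induction is
available. -/
theorem exists_isTreePairing [DecidableEq V] (hp : 0 < p) (i : Fin p → V)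
    (hedge : ∀ r, ∃ s, s ≠ r ∧ cycEdge i s = cycEdge i r)
    (hV : p + 2 ≤ 2 * (Finset.univ.image i).card) :
    Even p ∧ 2 * (Finset.univ.image i).card = p + 2 ∧ ∃ π, IsTreePairing i π := by
  have : NeZero p := ⟨hp.ne'⟩
  set w : ℕ → V := fun t => i (Fin.ofNat p t) with hw
  have hwr : ∀ r : Fin p, w r = i r := fun r => by rw [hw]; simp only [ofNat_val_eq]
  have hws : ∀ r : Fin p, w (r + 1) = i (finRotate p r) := fun r => by
    rw [hw]; simp only [ofNat_succ_eq_finRotate]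
  have hwe : ∀ r : Fin p, walkEdge w r = cycEdge i r := fun r => by
    rw [walkEdge, cycEdge, hwr, hws]
  have himage : (Finset.range (p + 1)).image w = Finset.univ.image i := by
    ext v
    simp only [Finset.mem_image, Finset.mem_univ, true_and]
    constructor
    · rintro ⟨t, -, rfl⟩; exact ⟨_, rfl⟩
    · rintro ⟨r, rfl⟩
      exact ⟨r, Finset.mem_range.2 (by omega), hwr r⟩
  have hclosed : w p = w 0 := by
    simp only [hw]; congr 1; ext; simp
  have hmult : ∀ t < p, ∃ s < p, s ≠ t ∧ walkEdge w s = walkEdge w t := by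
    intro t ht
    obtain ⟨s, hs, he⟩ := hedge ⟨t, ht⟩
    refine ⟨s, s.2, fun h => hs (Fin.ext h), ?_⟩
    rw [hwe, he, ← hwe]
  obtain ⟨h1, h2, f, hf⟩ := exists_isTreeWalk p w hclosed hmult (by rwa [himage])
  rw [himage] at h2
  refine ⟨h1, h2, ⟨fun r => ⟨f r, hf.pairing.lt r r.2⟩, fun r => ⟨f r, hf.pairing.lt r r.2⟩,
    fun r => Fin.ext (hf.pairing.involutive r r.2),
    fun r => Fin.ext (hf.pairing.involutive r r.2)⟩, ⟨?_, ?_, ?_⟩, ?_, ?_, ?_⟩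
  · exact fun r => Fin.ext (hf.pairing.involutive r r.2)
  · exact fun r h => hf.pairing.ne r r.2 (congrArg Fin.val h)
  · rintro r s ⟨h1, h2, h3⟩
    exact hf.pairing.nonCrossing r s h1 h2 h3 (hf.pairing.lt s s.2)
  · intro r
    have := hf.right r r.2
    rw [hwr] at this
    rw [← this]
    exact (hws ⟨f r, hf.pairing.lt r r.2⟩).symm
  · intro s t h
    rw [← hwe, ← hwe] at h
    exact (hf.edge s s.2 t t.2 h).imp (fun h => Fin.ext h) fun h => Fin.ext h
  · intro r
    rw [← hwr, ← hws]
    exact hf.loopless r r.2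

/-- A non-crossing pairing compatible with a labelling by many labels is determined by it. -/
lemma IsTreePairing.eq {i : Fin p → V} {π π' : Equiv.Perm (Fin p)} (h : IsTreePairing i π)
    (hπ' : IsNCPairing π') (h' : Compatible π' i) : π' = π := by
  ext r
  rcases h.edge _ _ (h'.cycEdge_eq hπ' r) with h | h
  · exact absurd h (hπ'.fixedPointFree r)
  · rw [h]

/-- The pairing itself is a bijection between left and right ends of blocks. -/
lemma card_openers {π : Equiv.Perm (Fin p)} (hπ : IsNCPairing π) :
    2 * (Finset.univ.filter fun r => r < π r).card = p := by
  have h1 := Finset.card_filter_add_card_filter_not (s := (Finset.univ : Finset (Fin p)))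
    (fun r => r < π r)
  have h2 : (Finset.univ.filter fun r => ¬ r < π r).card
      = (Finset.univ.filter fun r => r < π r).card := by
    refine Finset.card_nbij' π π ?_ ?_ ?_ ?_
    · intro r hr
      simp only [Finset.coe_filter, Finset.mem_univ, true_and, Set.mem_ofPred_eq] at hr ⊢
      rw [hπ.involutive]
      exact lt_of_le_of_ne (not_lt.1 hr) (hπ.fixedPointFree r)
    · intro r hr
      simp only [Finset.coe_filter, Finset.mem_univ, true_and, Set.mem_ofPred_eq] at hr ⊢
      rw [hπ.involutive]
      exact hr.le.not_gt
    · exact fun r _ => hπ.involutive r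
    · exact fun r _ => hπ.involutive r
  rw [Finset.card_univ, Fintype.card_fin] at h1
  omega

/-- The end point of the innermost arc of `π` above the vertex `t`, shifted by one; it is `0` if
there is no such arc. -/
def arcLabel (π : Equiv.Perm (Fin p)) (t : Fin p) : ℕ :=
  (Finset.univ.filter fun r => r < t ∧ t ≤ π r).sup fun r => (r : ℕ) + 1

/-- If `π r < r`, both vertices lie just inside the arc from `π r` to `r`, which is the innermost
one above them. If `r < π r`, the vertices lie just before and just after an arc, and non-crossing
forces the same arcs to cover both. When `π r` is the last time, the rotation wraps around to vertex
`0`, and no arc covers either vertex. -/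
lemma arcLabel_compatible {π : Equiv.Perm (Fin p)} (hπ : IsNCPairing π) :
    Compatible π (arcLabel π) := by
  have hinv := hπ.involutive
  have hfix := hπ.fixedPointFree
  have hnc := hπ.nonCrossing
  have hval : ∀ r s : Fin p, π r = s → π s = r := fun r s h => by rw [← h, hinv]
  intro r
  unfold arcLabel
  by_cases hr : (π r : ℕ) + 1 < p
  · have hrot : (finRotate p (π r) : ℕ) = π r + 1 := by
      rw [val_finRotate, Nat.mod_eq_of_lt hr]
    have hlt : ∀ x : Fin p, x < finRotate p (π r) ↔ x ≤ π r := by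
      intro x; rw [Fin.lt_def, Fin.le_def, hrot]; omega
    have hle : ∀ x : Fin p, finRotate p (π r) ≤ x ↔ π r < x := by
      intro x; rw [Fin.lt_def, Fin.le_def, hrot]; omega
    simp only [hlt, hle]
    obtain hrr | hrr := lt_or_gt_of_ne (hfix r)
    · have key : ∀ A : Finset (Fin p), π r ∈ A → (∀ x ∈ A, x ≤ π r) →
          (A.sup fun r => (r : ℕ) + 1) = π r + 1 := by
        intro A hA hA'
        refine le_antisymm (Finset.sup_le fun x hx => ?_)
          (Finset.le_sup (f := fun r : Fin p => (r : ℕ) + 1) hA)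
        have := Fin.le_def.1 (hA' x hx)
        omega
      rw [key, key]
      · simp only [Finset.mem_filter, Finset.mem_univ, true_and, hinv]
        exact ⟨hrr, le_rfl⟩
      · simp only [Finset.mem_filter, Finset.mem_univ, true_and]
        rintro x ⟨hx1, hx2⟩
        by_contra hcon
        push Not at hcon
        have h1 : r ≠ π x := fun h => by
          rw [hval x r h.symm] at hcon; exact lt_irrefl _ hcon
        refine hnc (π r) x ⟨hcon, ?_, ?_⟩
        · rwa [hinv]
        · rw [hinv]; exact lt_of_le_of_ne hx2 h1
      · simp only [Finset.mem_filter, Finset.mem_univ, true_and, hinv]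
        exact ⟨le_rfl, hrr⟩
      · simp only [Finset.mem_filter, Finset.mem_univ, true_and]
        exact fun x hx => hx.1
    · congr 1
      ext x
      simp only [Finset.mem_filter, Finset.mem_univ, true_and]
      constructor
      · rintro ⟨h1, h2⟩
        have hx1 : x ≠ π r := fun h => by rw [h, hinv] at h2; exact lt_asymm hrr h2
        have hx2 : x ≠ r := fun h => by rw [h] at h2; exact lt_irrefl _ h2
        have hxr : x < r := by
          by_contra hcon
          exact hnc r x ⟨lt_of_le_of_ne (not_lt.1 hcon) hx2.symm, lt_of_le_of_ne h1 hx1, h2⟩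
        exact ⟨hxr, (hrr.trans h2).le⟩
      · rintro ⟨h1, h2⟩
        have hx1 : r ≠ π x := fun h => by
          have := hval x r h.symm
          rw [← this] at h1
          exact lt_asymm hrr h1
        have hx2 : π x ≠ π r := fun h => by
          rw [π.injective h] at h1; exact lt_irrefl _ h1
        refine ⟨(h1.trans hrr).le, ?_⟩
        by_contra hcon
        exact hnc x r ⟨h1, lt_of_le_of_ne h2 hx1, lt_of_le_of_ne (not_lt.1 hcon) hx2⟩
  · have hp : (π r : ℕ) + 1 = p := by omega
    have hrot : (finRotate p (π r) : ℕ) = 0 := by rw [val_finRotate, hp, Nat.mod_self]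
    have hlast : ∀ x : Fin p, x ≤ π r := fun x => by rw [Fin.le_def]; omega
    rw [Finset.filter_false_of_mem, Finset.filter_false_of_mem]
    · rintro x - ⟨h1, h2⟩
      have hx1 : r ≠ π x := fun h => by
        have := hval x r h.symm
        rw [← this] at h1
        exact absurd (hlast r) (not_le.2 h1)
      have hx2 : π x ≠ π r := fun h => by
        rw [π.injective h] at h1; exact lt_irrefl _ h1
      exact hnc x r ⟨h1, lt_of_le_of_ne h2 hx1, lt_of_le_of_ne (hlast _) hx2⟩
    · rintro x - ⟨h1, -⟩
      rw [Fin.lt_def, hrot] at h1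
      omega

/-- Vertex `0` has label `0`, and the vertex following an opener `r` has label `r + 1`; there are `p
/ 2` openers. -/
lemma le_card_image_arcLabel {π : Equiv.Perm (Fin p)} (hπ : IsNCPairing π) (hp : 0 < p) :
    p + 2 ≤ 2 * (Finset.univ.image (arcLabel π)).card := by
  have hsub : insert 0 ((Finset.univ.filter fun r => r < π r).image fun r : Fin p => (r : ℕ) + 1)
      ⊆ Finset.univ.image (arcLabel π) := by
    intro v hv
    simp only [Finset.mem_insert, Finset.mem_image, Finset.mem_filter, Finset.mem_univ,
      true_and] at hv ⊢
    rcases hv with rfl | ⟨r, hr, rfl⟩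
    · refine ⟨⟨0, hp⟩, ?_⟩
      rw [arcLabel, Finset.filter_false_of_mem]
      · simp
      · rintro x - ⟨h1, -⟩
        exact absurd (Fin.lt_def.1 h1) (by simp)
    · have hrot : (finRotate p r : ℕ) = r + 1 := by
        rw [val_finRotate, Nat.mod_eq_of_lt]
        have := Fin.lt_def.1 hr
        omega
      refine ⟨finRotate p r, le_antisymm (Finset.sup_le fun x hx => ?_)
        (Finset.le_sup (f := fun r : Fin p => (r : ℕ) + 1) ?_)⟩
      · simp only [Finset.mem_filter, Finset.mem_univ, true_and, Fin.lt_def, hrot] at hx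
        omega
      · simp only [Finset.mem_filter, Finset.mem_univ, true_and, Fin.lt_def, Fin.le_def, hrot]
        exact ⟨by omega, Fin.lt_def.1 hr⟩
  have hcard := Finset.card_le_card hsub
  rw [Finset.card_insert_of_notMem (by simp), Finset.card_image_of_injective _
    fun a b h => Fin.ext (by simpa using h)] at hcard
  have := card_openers hπ
  omega

open Classical in
/-- The number of labellings compatible with a non-crossing pairing. -/
theorem card_compatible {k : ℕ} (hk : 0 < k) {π : Equiv.Perm (Fin (2 * k))} (hπ : IsNCPairing π)
    (n : ℕ) : (Finset.univ.filter fun i : Fin (2 * k) → Fin n => Compatible π i).card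
      = n ^ (k + 1) := by
  have hp : 0 < 2 * k := by omega
  set rel : Fin (2 * k) → Fin (2 * k) → Prop := fun s r => s = finRotate (2 * k) (π r) with hrel
  let _ : Fintype (Quot rel) := Fintype.ofFinite _
  -- Compatible labellings are arbitrary labellings of the classes of identified vertices, so only
  -- the number of classes has to be found.
  let e : {i : Fin (2 * k) → Fin n // Compatible π i} ≃ (Quot rel → Fin n) :=
    { toFun := fun i => Quot.lift i.1 (by rintro s r rfl; exact i.2 r)
      invFun := fun g => ⟨fun r => g (Quot.mk _ r), fun r => congrArg g (Quot.sound rfl)⟩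
      left_inv := fun i => rfl
      right_inv := fun g => by ext ⟨r⟩; rfl }
  have hcomp : Compatible π (Quot.mk rel) := fun r => Quot.sound rfl
  have himage : Finset.univ.image (Quot.mk rel) = Finset.univ := by
    ext ⟨r⟩; simp only [Finset.mem_image, Finset.mem_univ, true_and, iff_true]; exact ⟨r, rfl⟩
  have hlow : 2 * k + 2 ≤ 2 * Fintype.card (Quot rel) := by
    refine (le_card_image_arcLabel hπ hp).trans (Nat.mul_le_mul_left 2 ?_)
    have hlift : arcLabel π
        = (Quot.lift (arcLabel π) (by rintro s r rfl; exact arcLabel_compatible hπ r) :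
            Quot rel → ℕ) ∘ Quot.mk rel := rfl
    rw [hlift, ← Finset.image_image, himage]
    exact Finset.card_image_le
  -- The quotient map is a compatible labelling with every edge repeated. As `arcLabel` factors
  -- through it, it has at least `k + 1` values, and the tree lemma turns this into equality.
  have hc : Fintype.card (Quot rel) = k + 1 := by
    have := (exists_isTreePairing hp (Quot.mk rel) (hcomp.exists_edge hπ)
      (by rwa [himage, Finset.card_univ])).2.1
    rw [himage, Finset.card_univ] at this
    omega
  rw [← Fintype.card_subtype, Fintype.card_congr e, Fintype.card_fun, hc, Fintype.card_fin]

/-- The number of labellings by few labels. -/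
lemma card_few_labels (p n v : ℕ) (hp : 0 < p) :
    (Finset.univ.filter fun i : Fin p → Fin n => (Finset.univ.image i).card ≤ v).card
      ≤ v ^ p * n ^ v := by
  have hle : (Finset.univ.filter fun i : Fin p → Fin n => (Finset.univ.image i).card ≤ v)
      ⊆ Finset.univ.image fun x : (Fin p → Fin v) × (Fin v → Fin n) => x.2 ∘ x.1 := by
    intro i hi
    simp only [Finset.mem_filter, Finset.mem_univ, true_and, Finset.mem_image] at hi ⊢
    set I := Finset.univ.image i with hI
    have hmem : ∀ r, i r ∈ I := fun r => Finset.mem_image_of_mem _ (Finset.mem_univ r)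
    refine ⟨⟨fun r => Fin.castLE hi (I.equivFin ⟨i r, hmem r⟩),
      fun x => if h : (x : ℕ) < I.card then (I.equivFin.symm ⟨x, h⟩ : Fin n) else i ⟨0, hp⟩⟩, ?_⟩
    ext r
    simp
  refine (Finset.card_le_card hle).trans (Finset.card_image_le.trans ?_)
  simp [Finset.card_univ]

end Labellings

/-! ## Recursive evaluation of sums over non-crossing pairings -/

section WickSums

/-- The sum over the non-crossing ways to pair the letters of the stack `S` with letters of the
word `l`, and the other letters of `l` with each other, where the word is read from the left and a
block `{x, s}` has weight `c x s`. -/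
def wickSum {K : Type*} (c : K → K → ℂ) : List K → List K → ℂ
  | [], [] => 1
  | [], _ :: _ => 0
  | x :: l, [] => wickSum c l [x]
  | x :: l, s :: S => wickSum c l (x :: s :: S) + c x s * wickSum c l S

lemma wickSum_map {K L : Type*} (g : L → K) (c : K → K → ℂ) (l S : List L) :
    wickSum c (l.map g) (S.map g) = wickSum (fun x y => c (g x) (g y)) l S := by
  induction l generalizing S with
  | nil => cases S <;> rfl
  | cons x l ih =>
    cases S with
    | nil => exact ih [x]
    | cons s S =>
      have h1 := ih (x :: s :: S)
      have h2 := ih S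
      simp only [List.map_cons] at h1 ⊢
      rw [wickSum, wickSum, h1, h2]

/-- Pushing a letter keeps the total length and pairing one lowers it by two, so the parity is
invariant, whereas a nonzero end value needs total length zero. -/
lemma wickSum_eq_zero_of_odd {K : Type*} (c : K → K → ℂ) (l S : List K)
    (h : Odd (l.length + S.length)) : wickSum c l S = 0 := by
  induction l generalizing S with
  | nil =>
    cases S with
    | nil => simp at h
    | cons s S => rfl
  | cons x l ih =>
    cases S with
    | nil => exact ih [x] (by simpa using h)
    | cons s S =>
      rw [wickSum, ih, ih, mul_zero, add_zero]
      · simp only [List.length_cons, Nat.odd_iff] at h ⊢; omega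
      · simp only [List.length_cons, Nat.odd_iff] at h ⊢; omega

variable {p : ℕ}

/-- The list `[t - 1, …, 0]`. -/
def downFrom (p : ℕ) : (t : ℕ) → t ≤ p → List (Fin p)
  | 0, _ => []
  | t + 1, h => ⟨t, h⟩ :: downFrom p t (Nat.le_of_succ_le h)

/-- A non-crossing involution of the points which are at least `t`, such that no fixed point lies
below an arc. -/
structure IsPartialPairing (t : ℕ) (f : Fin p → Fin p) : Prop where
  involutive : ∀ x, f (f x) = x
  fixed : ∀ x : Fin p, (x : ℕ) < t → f x = x
  nonCrossing : ∀ r s, ¬ (r < s ∧ s < f r ∧ f r < f s)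
  covered : ∀ r x, r < x → x < f r → f x ≠ x

/-- The pairings which extend a partial one, so that its fixed points beyond `t` are paired with
points below `t`. -/
structure IsCompletion (t : ℕ) (f : Fin p → Fin p) (π : Equiv.Perm (Fin p)) : Prop where
  pairing : IsNCPairing π
  extend : ∀ x, f x ≠ x → π x = f x
  fixed : ∀ x : Fin p, t ≤ x → f x = x → (π x : ℕ) < t

/-- The arc `{t, s}` is added to an involution. -/
def addArc (t s : Fin p) (f : Fin p → Fin p) (x : Fin p) : Fin p :=
  if x = t then s else if x = s then t else f x

lemma addArc_left (t s : Fin p) (f : Fin p → Fin p) : addArc t s f t = s := by simp [addArc]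

lemma addArc_right (t s : Fin p) (f : Fin p → Fin p) : addArc t s f s = t := by
  by_cases h : s = t <;> simp [addArc, h]

lemma addArc_of_ne {t s : Fin p} (f : Fin p → Fin p) {x : Fin p} (h1 : x ≠ t) (h2 : x ≠ s) :
    addArc t s f x = f x := by simp [addArc, h1, h2]

lemma IsPartialPairing.mono {t : ℕ} {f : Fin p → Fin p} (hf : IsPartialPairing (t + 1) f) :
    IsPartialPairing t f :=
  ⟨hf.involutive, fun x hx => hf.fixed x (by omega), hf.nonCrossing, hf.covered⟩

/-- As `s` is the first waiting point after `t`, the new arc covers no waiting point. An old arc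
starting below it and ending beyond `s` would have covered `s`, so nothing crosses. -/
lemma IsPartialPairing.addArc {t s : Fin p} {f : Fin p → Fin p}
    (hf : IsPartialPairing ((t : ℕ) + 1) f) (hts : t < s) (hs : f s = s)
    (hmin : ∀ x, t < x → x < s → f x ≠ x) : IsPartialPairing t (addArc t s f) := by
  have ht : f t = t := hf.fixed t (by omega)
  have hne : ∀ x, x ≠ t → x ≠ s → f x ≠ t ∧ f x ≠ s := by
    intro x h1 h2
    exact ⟨fun h => h1 (by rw [← hf.involutive x, h, ht]),
      fun h => h2 (by rw [← hf.involutive x, h, hs])⟩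
  have hlow : ∀ x, x ≤ t → f x = x := fun x hx => hf.fixed x (by
    have := Fin.le_def.1 hx; omega)
  have hlt : ∀ r, r < f r → t < r := by
    intro r hr
    by_contra hcon
    rw [hlow r (not_lt.1 hcon)] at hr
    exact lt_irrefl _ hr
  refine ⟨fun x => ?_, fun x hx => ?_, ?_, ?_⟩
  · by_cases h1 : x = t
    · rw [h1, addArc_left, addArc_right]
    by_cases h2 : x = s
    · rw [h2, addArc_right, addArc_left]
    rw [addArc_of_ne f h1 h2, addArc_of_ne f (hne x h1 h2).1 (hne x h1 h2).2, hf.involutive]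
  · have hxt : x < t := hx
    rw [addArc_of_ne f hxt.ne (hxt.trans hts).ne, hlow x hxt.le]
  · rintro r x ⟨h1, h2, h3⟩
    by_cases hr : r = t
    · subst hr
      rw [addArc_left] at h2 h3
      rw [addArc_of_ne f h1.ne' h2.ne] at h3
      exact hf.covered x s h2 h3 hs
    by_cases hr' : r = s
    · subst hr'
      rw [addArc_right] at h2
      exact lt_asymm (hts.trans h1) h2
    rw [addArc_of_ne f hr hr'] at h2 h3
    have htr := hlt r (h1.trans h2)
    by_cases hx : x = s
    · subst hx
      rw [addArc_right] at h3
      exact lt_asymm (h2.trans h3) hts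
    rw [addArc_of_ne f (htr.trans h1).ne' hx] at h3
    exact hf.nonCrossing r x ⟨h1, h2, h3⟩
  · intro r x h1 h2 h3
    by_cases hxt : x = t
    · rw [hxt, addArc_left] at h3; exact hts.ne' h3
    by_cases hxs : x = s
    · rw [hxs, addArc_right] at h3; exact hts.ne h3
    rw [addArc_of_ne f hxt hxs] at h3
    by_cases hr : r = t
    · subst hr
      rw [addArc_left] at h2
      exact hmin x h1 h2 h3
    by_cases hr' : r = s
    · subst hr'
      rw [addArc_right] at h2
      exact lt_asymm (hts.trans h1) h2
    rw [addArc_of_ne f hr hr'] at h2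
    exact hf.covered r x h1 h2 h3

lemma isCompletion_succ_iff_of_lt {t : Fin p} {f : Fin p → Fin p}
    (hf : IsPartialPairing ((t : ℕ) + 1) f) (π : Equiv.Perm (Fin p)) :
    IsCompletion (t : ℕ) f π ↔ IsCompletion ((t : ℕ) + 1) f π ∧ π t < t := by
  constructor
  · refine fun h => ⟨⟨h.pairing, h.extend, fun x hx hfx => ?_⟩, ?_⟩
    · have := h.fixed x (by omega) hfx; omega
    · exact h.fixed t le_rfl (hf.fixed t (by omega))
  · rintro ⟨h, ht⟩
    refine ⟨h.pairing, h.extend, fun x hx hfx => ?_⟩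
    by_cases hxt : x = t
    · rw [hxt]; exact ht
    · have hxt' : (x : ℕ) ≠ t := fun h => hxt (Fin.ext h)
      have h1 := h.fixed x (by omega) hfx
      have h2 : (π x : ℕ) ≠ t := by
        intro h2
        have h2 : π x = t := Fin.ext h2
        rw [← h2, h.pairing.involutive, h2, Fin.lt_def] at ht
        omega
      omega

/-- If `t` opens an arc, its partner must be the first waiting point `s`: otherwise `s` would be
paired with a point below `t`, and its arc would cross that of `t`. -/
lemma isCompletion_succ_iff_of_gt {t s : Fin p} {f : Fin p → Fin p}
    (hf : IsPartialPairing ((t : ℕ) + 1) f) (hts : t < s) (hs : f s = s)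
    (hmin : ∀ x, t < x → x < s → f x ≠ x) (π : Equiv.Perm (Fin p)) :
    IsCompletion (t : ℕ) (addArc t s f) π ↔ IsCompletion ((t : ℕ) + 1) f π ∧ t < π t := by
  have ht : f t = t := hf.fixed t (by omega)
  constructor
  · intro h
    have hπt : π t = s := by
      have := h.extend t (by rw [addArc_left]; exact hts.ne')
      rwa [addArc_left] at this
    have hπs : π s = t := by rw [← hπt, h.pairing.involutive]
    refine ⟨⟨h.pairing, fun x hx => ?_, fun x hx hfx => ?_⟩, hπt ▸ hts⟩
    · have h1 : x ≠ t := by rintro rfl; exact hx ht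
      have h2 : x ≠ s := by rintro rfl; exact hx hs
      have := h.extend x (by rwa [addArc_of_ne f h1 h2])
      rwa [addArc_of_ne f h1 h2] at this
    · by_cases hxs : x = s
      · rw [hxs, hπs]; omega
      · have hxt : x ≠ t := by rintro rfl; omega
        have := h.fixed x (by omega) (by rwa [addArc_of_ne f hxt hxs])
        omega
  · rintro ⟨h, hlt⟩
    have hfix : f (π t) = π t := by
      by_contra hcon
      have h1 := h.extend _ hcon
      rw [h.pairing.involutive] at h1
      have h2 := hf.involutive (π t)
      rw [← h1, ht] at h2
      exact hlt.ne h2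
    have hπt : π t = s := by
      by_contra hcon
      have h1 : s < π t := by
        by_contra h1
        exact hmin _ hlt (lt_of_le_of_ne (not_lt.1 h1) hcon) hfix
      have h2 := h.fixed s (by have := Fin.lt_def.1 hts; omega) hs
      have h3 : π s ≠ t := by
        intro h3
        rw [← h3, h.pairing.involutive] at hcon
        exact hcon rfl
      have h4 : (π s : ℕ) ≠ t := fun h => h3 (Fin.ext h)
      refine h.pairing.nonCrossing (π s) t ⟨?_, ?_, ?_⟩
      · rw [Fin.lt_def]; omega
      · rwa [h.pairing.involutive]
      · rwa [h.pairing.involutive]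
    have hπs : π s = t := by rw [← hπt, h.pairing.involutive]
    refine ⟨h.pairing, fun x hx => ?_, fun x hx hfx => ?_⟩
    · by_cases h1 : x = t
      · rw [h1, addArc_left, hπt]
      by_cases h2 : x = s
      · rw [h2, addArc_right, hπs]
      rw [addArc_of_ne f h1 h2] at hx ⊢
      exact h.extend x hx
    · have h1 : x ≠ t := by rintro rfl; rw [addArc_left] at hfx; exact hts.ne' hfx
      have h2 : x ≠ s := by rintro rfl; rw [addArc_right] at hfx; exact hts.ne hfx
      rw [addArc_of_ne f h1 h2] at hfx
      have h1' : (x : ℕ) ≠ t := fun h => h1 (Fin.ext h)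
      have h3 := h.fixed x (by omega) hfx
      have h4 : (π x : ℕ) ≠ t := by
        intro h4
        have h4 : π x = t := Fin.ext h4
        rw [← hπs] at h4
        exact h2 (π.injective h4)
      omega

open Classical in
-- Times are treated in decreasing order. The involution `f` stores the arcs already fixed, and the
-- stack `S` lists the waiting points, which must be paired below `t`, in increasing order. The next
-- time either joins the waiting points or is paired with the head of the stack; these are the two
-- terms of the recursion `wickSum`. Only arcs whose left end is still to come are weighted.
lemma sum_completions (c : Fin p → Fin p → ℂ) (t : ℕ) (ht : t ≤ p) (f : Fin p → Fin p)
    (hf : IsPartialPairing t f) (S : List (Fin p)) (hS : S.Pairwise (· < ·))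
    (hmem : ∀ x : Fin p, x ∈ S ↔ t ≤ (x : ℕ) ∧ f x = x) :
    ∑ π : Equiv.Perm (Fin p) with IsCompletion t f π,
      ∏ r : Fin p with r < π r ∧ (r : ℕ) < t, c r (π r) = wickSum c (downFrom p t ht) S := by
  induction t generalizing f S with
  | zero =>
    cases S with
    | nil =>
      have hfix : ∀ x, f x ≠ x := fun x hx => by simpa using (hmem x).2 ⟨Nat.zero_le _, hx⟩
      have heq : (Finset.univ.filter fun π : Equiv.Perm (Fin p) => IsCompletion 0 f π)
          = {Function.Involutive.toPerm f hf.involutive} := by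
        ext π
        simp only [Finset.mem_filter, Finset.mem_univ, true_and, Finset.mem_singleton]
        constructor
        · intro h; ext x; rw [h.extend x (hfix x)]; rfl
        · rintro rfl
          exact ⟨⟨hf.involutive, hfix, hf.nonCrossing⟩, fun x _ => rfl,
            fun x _ h => absurd h (hfix x)⟩
      rw [heq, Finset.sum_singleton]
      simp [downFrom, wickSum]
    | cons s S =>
      rw [Finset.filter_false_of_mem]
      · simp [downFrom, wickSum]
      · intro π _ h
        exact absurd (h.fixed s (Nat.zero_le _) ((hmem s).1 (by simp)).2) (by omega)
  | succ t ih =>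
    set T : Fin p := ⟨t, ht⟩ with hT
    have hfT : f T = T := hf.fixed T (by simp [hT])
    have hsplit := Finset.sum_filter_add_sum_filter_not
      (Finset.univ.filter fun π : Equiv.Perm (Fin p) => IsCompletion (t + 1) f π)
      (fun π => π T < T)
      (fun π => ∏ r : Fin p with r < π r ∧ (r : ℕ) < t + 1, c r (π r))
    rw [← hsplit, Finset.filter_filter, Finset.filter_filter]
    have hfirst : ∑ π : Equiv.Perm (Fin p) with IsCompletion (t + 1) f π ∧ π T < T,
        ∏ r : Fin p with r < π r ∧ (r : ℕ) < t + 1, c r (π r)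
          = wickSum c (downFrom p t (Nat.le_of_succ_le ht)) (T :: S) := by
      rw [← ih (Nat.le_of_succ_le ht) f hf.mono (T :: S)]
      · refine Finset.sum_congr ?_ ?_
        · ext π
          simp only [Finset.mem_filter, Finset.mem_univ, true_and]
          exact (isCompletion_succ_iff_of_lt (t := T) hf π).symm
        · intro π hπ
          simp only [Finset.mem_filter, Finset.mem_univ, true_and] at hπ
          have hlt : π T < T := hπ.fixed T le_rfl hfT
          refine Finset.prod_congr ?_ fun _ _ => rfl
          ext r
          simp only [Finset.mem_filter, Finset.mem_univ, true_and]
          refine ⟨fun ⟨h1, h2⟩ => ⟨h1, ?_⟩, fun ⟨h1, h2⟩ => ⟨h1, by omega⟩⟩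
          have : r ≠ T := by rintro rfl; exact lt_asymm h1 hlt
          have : (r : ℕ) ≠ t := fun h => this (Fin.ext h)
          omega
      · rw [List.pairwise_cons]
        refine ⟨fun x hx => ?_, hS⟩
        have := ((hmem x).1 hx).1
        rw [Fin.lt_def]; exact this
      · intro x
        rw [List.mem_cons, hmem]
        constructor
        · rintro (rfl | ⟨h1, h2⟩)
          · exact ⟨le_rfl, hfT⟩
          · exact ⟨by omega, h2⟩
        · rintro ⟨h1, h2⟩
          by_cases hx : x = T
          · exact Or.inl hx
          · have : (x : ℕ) ≠ t := fun h => hx (Fin.ext h)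
            exact Or.inr ⟨by omega, h2⟩
    rw [hfirst]
    -- With no waiting point the current time cannot open an arc, so only the first branch remains.
    cases S with
    | nil =>
      rw [Finset.filter_false_of_mem, Finset.sum_empty, add_zero]
      · rfl
      · rintro π - ⟨h, hlt⟩
        have hgt : T < π T := lt_of_le_of_ne (not_lt.1 hlt) (h.pairing.fixedPointFree T).symm
        have hfix : f (π T) ≠ π T := fun h' => by
          simpa using (hmem _).2 ⟨Nat.succ_le_of_lt (Fin.lt_def.1 hgt), h'⟩
        have h1 := h.extend _ hfix
        rw [h.pairing.involutive] at h1
        have h2 := hf.involutive (π T)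
        rw [← h1, hfT] at h2
        exact hgt.ne h2
    | cons s S =>
      rw [List.pairwise_cons] at hS
      obtain ⟨hs1, hs2⟩ := (hmem s).1 (by simp)
      have hTs : T < s := by rw [Fin.lt_def]; exact hs1
      have hmin : ∀ x, T < x → x < s → f x ≠ x := by
        intro x h1 h2 h3
        have := (hmem x).2 ⟨Nat.succ_le_of_lt (Fin.lt_def.1 h1), h3⟩
        rcases List.mem_cons.1 this with rfl | h
        · exact lt_irrefl _ h2
        · exact lt_asymm h2 (hS.1 x h)
      have hiff := isCompletion_succ_iff_of_gt (t := T) hf hTs hs2 hmin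
      rw [downFrom, wickSum, ← hT,
        ← ih (Nat.le_of_succ_le ht) (addArc T s f) (hf.addArc (t := T) hTs hs2 hmin) S hS.2,
        Finset.mul_sum]
      · congr 1
        refine Finset.sum_congr ?_ ?_
        · ext π
          simp only [Finset.mem_filter, Finset.mem_univ, true_and]
          rw [show t = (T : ℕ) from rfl, hiff π]
          refine and_congr_right fun h => ?_
          rw [not_lt]
          exact ⟨fun h' => lt_of_le_of_ne h' (h.pairing.fixedPointFree T).symm, le_of_lt⟩
        · intro π hπ
          simp only [Finset.mem_filter, Finset.mem_univ, true_and] at hπ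
          have hπT : π T = s := by
            have := hπ.extend T (by rw [addArc_left]; exact hTs.ne')
            rwa [addArc_left] at this
          have hset : (Finset.univ.filter fun r : Fin p => r < π r ∧ (r : ℕ) < t + 1)
              = insert T (Finset.univ.filter fun r : Fin p => r < π r ∧ (r : ℕ) < t) := by
            ext r
            simp only [Finset.mem_filter, Finset.mem_univ, true_and, Finset.mem_insert]
            constructor
            · rintro ⟨h1, h2⟩
              by_cases hr : r = T
              · exact Or.inl hr
              · have : (r : ℕ) ≠ t := fun h => hr (Fin.ext h)
                exact Or.inr ⟨h1, by omega⟩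
            · rintro (rfl | ⟨h1, h2⟩)
              · exact ⟨by rw [hπT]; exact hTs, by simp [hT]⟩
              · exact ⟨h1, by omega⟩
          rw [hset, Finset.prod_insert (by simp [hT]), hπT]
      · intro x
        have hxs : x ∈ S ↔ x ∈ s :: S ∧ x ≠ s := by
          rw [List.mem_cons]
          constructor
          · exact fun h => ⟨Or.inr h, (hS.1 x h).ne'⟩
          · rintro ⟨h | h, h'⟩
            · exact absurd h h'
            · exact h
        rw [hxs, hmem]
        constructor
        · rintro ⟨⟨h1, h2⟩, h3⟩
          refine ⟨by omega, ?_⟩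
          rwa [addArc_of_ne f (fun h => by rw [h] at h1; simp [hT] at h1) h3]
        · rintro ⟨h1, h2⟩
          have h3 : x ≠ T := by rintro rfl; rw [addArc_left] at h2; exact hTs.ne' h2
          have h4 : x ≠ s := by rintro rfl; rw [addArc_right] at h2; exact hTs.ne h2
          rw [addArc_of_ne f h3 h4] at h2
          have : (x : ℕ) ≠ t := fun h => h3 (Fin.ext h)
          exact ⟨⟨by omega, h2⟩, h4⟩

lemma map_downFrom {K : Type*} (ε : Fin p → K) (t : ℕ) (ht : t ≤ p) :
    (downFrom p t ht).map ε = (List.ofFn fun j : Fin t => ε (Fin.castLE ht j)).reverse := by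
  induction t with
  | zero => simp [downFrom]
  | succ t ih =>
    rw [downFrom, List.map_cons, ih, List.ofFn_succ_last]
    simp only [List.reverse_append, List.reverse_cons, List.reverse_nil, List.nil_append,
      List.singleton_append]
    rfl

open Classical in
/-- The sum over the non-crossing pairings of the letters of a word. -/
theorem sum_ncPairings {K : Type*} (c : K → K → ℂ) (ε : Fin p → K) :
    ∑ π : Equiv.Perm (Fin p) with IsNCPairing π,
      ∏ r : Fin p with r < π r, c (ε r) (ε (π r)) = wickSum c (List.ofFn ε).reverse [] := by
  -- At `t = p` nothing has been treated: the identity has no arc, the stack is empty, and every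
  -- non-crossing pairing is a completion.
  have h := sum_completions (fun r s => c (ε r) (ε s)) p le_rfl id
    ⟨fun _ => rfl, fun _ _ => rfl, fun r s h => lt_asymm h.1 h.2.1,
      fun r x h1 h2 => absurd h1 h2.not_gt⟩ [] List.Pairwise.nil
    (fun x => by simp [x.2])
  rw [← wickSum_map ε, map_downFrom] at h
  refine Eq.trans (Finset.sum_congr ?_ fun π _ => Finset.prod_congr ?_ fun _ _ => rfl) h
  · ext π
    simp only [Finset.mem_filter, Finset.mem_univ, true_and]
    exact ⟨fun h => ⟨h, fun x hx => absurd rfl hx, fun x _ _ => (π x).2⟩, fun h => h.pairing⟩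
  · ext r
    simp

end WickSums

/-! ## Traces of words and expectations of products of entries -/

section Traces

lemma prod_ofFn_apply {ι R : Type*} [Fintype ι] [DecidableEq ι] [CommSemiring R] {m : ℕ}
    (A : Fin (m + 1) → Matrix ι ι R) (x y : ι) :
    (List.ofFn A).prod x y = ∑ i : Fin m → ι, ∏ r : Fin (m + 1),
      A r ((Fin.cons x i : Fin (m + 1) → ι) r) ((Fin.snoc i y : Fin (m + 1) → ι) r) := by
  induction m generalizing x with
  | zero => simp [Fin.snoc]
  | succ m ih =>
    rw [List.ofFn_succ, List.prod_cons, Matrix.mul_apply,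
      ← (Fin.consEquiv fun _ : Fin (m + 1) => ι).sum_comp, Fintype.sum_prod_type]
    refine Finset.sum_congr rfl fun z _ => ?_
    rw [ih, Finset.mul_sum]
    refine Finset.sum_congr rfl fun i _ => ?_
    rw [Fin.prod_univ_succ (n := m + 1)]
    change _ = A 0 ((Fin.cons x (Fin.cons z i : Fin (m + 1) → ι) : Fin (m + 2) → ι) 0)
      ((Fin.snoc (Fin.cons z i : Fin (m + 1) → ι) y : Fin (m + 2) → ι) 0) *
      ∏ r : Fin (m + 1), A r.succ
        ((Fin.cons x (Fin.cons z i : Fin (m + 1) → ι) : Fin (m + 2) → ι) r.succ)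
        ((Fin.snoc (Fin.cons z i : Fin (m + 1) → ι) y : Fin (m + 2) → ι) r.succ)
    rw [← Fin.cons_snoc_eq_snoc_cons]
    simp only [Fin.cons_zero, Fin.cons_succ]

/-- The trace of a product of matrices is a sum over closed walks. -/
theorem trace_prod_ofFn {ι R : Type*} [Fintype ι] [DecidableEq ι] [CommSemiring R] {p : ℕ}
    (hp : 0 < p) (A : Fin p → Matrix ι ι R) :
    (List.ofFn A).prod.trace = ∑ i : Fin p → ι, ∏ r, A r (i r) (i (finRotate p r)) := by
  obtain ⟨m, rfl⟩ : ∃ m, p = m + 1 := ⟨p - 1, by omega⟩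
  rw [← (Fin.consEquiv fun _ : Fin (m + 1) => ι).sum_comp, Fintype.sum_prod_type, Matrix.trace]
  refine Finset.sum_congr rfl fun x _ => ?_
  rw [Matrix.diag_apply, prod_ofFn_apply]
  refine Finset.sum_congr rfl fun i _ => Finset.prod_congr rfl fun r _ => ?_
  rw [Fin.snoc_eq_cons_rotate]
  rfl

/-- The entry of a real matrix or of its transpose. -/
def starEntry {n : ℕ} (A : Matrix (Fin n) (Fin n) ℝ) (ε : Bool) (x y : Fin n) : ℝ :=
  if ε then A y x else A x y

lemma prod_ofFn_pi {Ω R : Type*} [Monoid R] {p : ℕ} (f : Fin p → Ω → R) (ω : Ω) :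
    (List.ofFn f).prod ω = (List.ofFn fun j => f j ω).prod := by
  have := map_list_prod (Pi.evalMonoidHom (fun _ : Ω => R) ω) (List.ofFn f)
  rwa [List.map_ofFn] at this

lemma starWord_apply {Ω R : Type*} [Monoid R] [Star R] (x : Ω → R) {p : ℕ} (ε : Fin p → Bool)
    (ω : Ω) : starWord x ε ω = starWord (x ω) ε := by
  rw [starWord, starWord, prod_ofFn_pi]
  congr 2
  ext j
  split_ifs <;> rfl

lemma trace_starWord_scaled {n p : ℕ} (hp : 0 < p) {Ω : Type*}
    (a : Ω → Matrix (Fin n) (Fin n) ℝ) (ε : Fin p → Bool) (ω : Ω) :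
    (starWord (scaled a) ε ω).trace = (((√(n : ℝ))⁻¹ ^ p * ∑ i : Fin p → Fin n,
      ∏ r, starEntry (a ω) (ε r) (i r) (i (finRotate p r)) : ℝ) : ℂ) := by
  rw [starWord_apply, starWord, trace_prod_ofFn hp, Complex.ofReal_mul, Complex.ofReal_sum,
    Finset.mul_sum]
  refine Finset.sum_congr rfl fun i _ => ?_
  have : ∀ r, (if ε r = true then star (scaled a ω) else scaled a ω) (i r) (i (finRotate p r))
      = (((√(n : ℝ))⁻¹ : ℝ) : ℂ) * (starEntry (a ω) (ε r) (i r) (i (finRotate p r)) : ℂ) := by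
    intro r
    unfold starEntry scaled
    cases ε r
    · simp
    · simp [Matrix.star_apply]
  rw [Finset.prod_congr rfl fun r _ => this r, Finset.prod_mul_distrib]
  simp

end Traces

/-! ### Integrability and factorisation of products of entries -/

section Expectations

variable {Ω : Type*} [MeasurableSpace Ω]

/-- Every factor is at most the largest one. This replaces Hölder's inequality in bounding mixed
moments by absolute moments. -/
lemma abs_prod_le_sum_pow {ι : Type*} [Fintype ι] [Nonempty ι] (x : ι → ℝ) :
    |∏ r, x r| ≤ ∑ r, |x r| ^ Fintype.card ι := by
  obtain ⟨s, -, hs⟩ := Finset.exists_max_image Finset.univ (fun r => |x r|) Finset.univ_nonempty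
  rw [Finset.abs_prod]
  calc ∏ r, |x r| ≤ ∏ _r : ι, |x s| :=
        Finset.prod_le_prod (fun r _ => abs_nonneg _) fun r hr => hs r hr
    _ = |x s| ^ Fintype.card ι := by rw [Finset.prod_const, Finset.card_univ]
    _ ≤ ∑ r, |x r| ^ Fintype.card ι :=
        Finset.single_le_sum (f := fun r => |x r| ^ Fintype.card ι)
          (fun r _ => by positivity) (Finset.mem_univ s)

lemma integrable_prod_and_bound {P : Measure Ω} {ι : Type*} [Fintype ι] [Nonempty ι]
    {X : ι → Ω → ℝ} (hX : ∀ r, Measurable (X r)) {C : ℝ}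
    (hC : ∀ r, Integrable (fun ω => |X r ω| ^ Fintype.card ι) P ∧
      ∫ ω, |X r ω| ^ Fintype.card ι ∂P ≤ C) :
    Integrable (fun ω => ∏ r, X r ω) P ∧ |∫ ω, ∏ r, X r ω ∂P| ≤ Fintype.card ι * C := by
  have hint : Integrable (fun ω => ∑ r, |X r ω| ^ Fintype.card ι) P :=
    integrable_finsetSum _ fun r _ => (hC r).1
  refine ⟨hint.mono' (Finset.measurable_fun_prod _ fun r _ => hX r).aestronglyMeasurable
    (Eventually.of_forall fun ω => abs_prod_le_sum_pow _), ?_⟩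
  calc |∫ ω, ∏ r, X r ω ∂P| ≤ ∫ ω, ∑ r, |X r ω| ^ Fintype.card ι ∂P :=
        norm_integral_le_of_norm_le (f := fun ω => ∏ r, X r ω) hint
          (Eventually.of_forall fun ω => abs_prod_le_sum_pow _)
    _ = ∑ r, ∫ ω, |X r ω| ^ Fintype.card ι ∂P := integral_finsetSum _ fun r _ => (hC r).1
    _ ≤ ∑ _r : ι, C := Finset.sum_le_sum fun r _ => (hC r).2
    _ = Fintype.card ι * C := by rw [Finset.sum_const, Finset.card_univ, nsmul_eq_mul]

variable {n p : ℕ}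

/-- The two indices in increasing order. -/
def sortedPair (x y : Fin n) : {q : Fin n × Fin n // q.1 ≤ q.2} :=
  ⟨(min x y, max x y), min_le_max⟩

lemma sortedPair_eq_iff {x y z w : Fin n} :
    sortedPair x y = sortedPair z w ↔ s(x, y) = s(z, w) := by
  rw [Sym2.eq_iff, sortedPair, sortedPair, Subtype.mk.injEq, Prod.mk.injEq]
  constructor
  · rintro ⟨h1, h2⟩
    rcases le_total x y with h | h <;> rcases le_total z w with h' | h' <;>
      simp only [min_eq_left, min_eq_right, max_eq_left, max_eq_right, h, h'] at h1 h2 <;> tauto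
  · rintro (⟨rfl, rfl⟩ | ⟨rfl, rfl⟩)
    · exact ⟨rfl, rfl⟩
    · exact ⟨min_comm _ _, max_comm _ _⟩

/-- The coordinate of the pair `(aᵢⱼ, aⱼᵢ)`, `i ≤ j`, at which a given entry is found. -/
def pairCoord (ε : Bool) (x y : Fin n) (z : ℝ × ℝ) : ℝ :=
  if (x ≤ y ↔ ε = false) then z.1 else z.2

lemma measurable_pairCoord (ε : Bool) (x y : Fin n) : Measurable (pairCoord ε x y) := by
  unfold pairCoord
  split_ifs
  · exact measurable_fst
  · exact measurable_snd

lemma pairCoord_eq (A : Matrix (Fin n) (Fin n) ℝ) (ε : Bool) (x y : Fin n) :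
    pairCoord ε x y (A (sortedPair x y).1.1 (sortedPair x y).1.2,
      A (sortedPair x y).1.2 (sortedPair x y).1.1) = starEntry A ε x y := by
  unfold pairCoord starEntry sortedPair
  rcases le_or_gt x y with h | h
  · cases ε <;> simp [h]
  · cases ε <;> simp [h.le, h.not_ge]

lemma measurable_starEntry {a : Ω → Matrix (Fin n) (Fin n) ℝ}
    (ha : ∀ x y, Measurable fun ω => a ω x y) (ε : Bool) (x y : Fin n) :
    Measurable fun ω => starEntry (a ω) ε x y := by
  unfold starEntry
  split_ifs
  · exact ha y x
  · exact ha x y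

/-- The expected product of the entries of `a` along a closed walk. -/
def walkExp (P : Measure Ω) (a : Ω → Matrix (Fin n) (Fin n) ℝ) (ε : Fin p → Bool)
    (i : Fin p → Fin n) : ℝ :=
  ∫ ω, ∏ r, starEntry (a ω) (ε r) (i r) (i (finRotate p r)) ∂P

/-- The expectation factorises over the edges of the walk. -/
lemma walkExp_eq_prod {P : Measure Ω} [IsProbabilityMeasure P]
    {a : Ω → Matrix (Fin n) (Fin n) ℝ}
    (ha : ∀ x y, Measurable fun ω => a ω x y)
    (hind : iIndepFun
      (fun (q : {q : Fin n × Fin n // q.1 ≤ q.2}) (ω : Ω) =>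
        ((a ω q.1.1 q.1.2, a ω q.1.2 q.1.1) : ℝ × ℝ)) P)
    (ε : Fin p → Bool) (i : Fin p → Fin n) :
    walkExp P a ε i = ∏ q : {q : Fin n × Fin n // q.1 ≤ q.2}, ∫ ω,
      ∏ r with sortedPair (i r) (i (finRotate p r)) = q,
        starEntry (a ω) (ε r) (i r) (i (finRotate p r)) ∂P := by
  set G : {q : Fin n × Fin n // q.1 ≤ q.2} → ℝ × ℝ → ℝ := fun q z =>
    ∏ r with sortedPair (i r) (i (finRotate p r)) = q,
      pairCoord (ε r) (i r) (i (finRotate p r)) z with hG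
  have hGm : ∀ q, Measurable (G q) := fun q =>
    Finset.measurable_fun_prod _ fun r _ => measurable_pairCoord _ _ _
  have hZ : ∀ q : {q : Fin n × Fin n // q.1 ≤ q.2},
      Measurable fun ω => ((a ω q.1.1 q.1.2, a ω q.1.2 q.1.1) : ℝ × ℝ) :=
    fun q => (ha _ _).prodMk (ha _ _)
  have hGeq : ∀ q ω, ∏ r with sortedPair (i r) (i (finRotate p r)) = q,
      starEntry (a ω) (ε r) (i r) (i (finRotate p r))
        = G q (a ω q.1.1 q.1.2, a ω q.1.2 q.1.1) := by
    intro q ω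
    refine Finset.prod_congr rfl fun r hr => ?_
    obtain rfl := (Finset.mem_filter.1 hr).2
    exact (pairCoord_eq _ _ _ _).symm
  rw [walkExp]
  simp_rw [← Finset.prod_fiberwise Finset.univ
    (fun r => sortedPair (i r) (i (finRotate p r))), hGeq]
  exact (hind.comp G hGm).integral_fun_prod_eq_prod_integral
    fun q => ((hGm q).comp (hZ q)).aestronglyMeasurable

end Expectations

/-! ### Expectations along closed walks for generalised elliptic matrices -/

section Elliptic

variable {Ω : ℕ → Type*} [∀ n, MeasurableSpace (Ω n)] {P : ∀ n, Measure (Ω n)}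
  {a : ∀ n, Ω n → Matrix (Fin n) (Fin n) ℝ} {ρ : ℕ → ℕ → ℝ}

lemma IsGeneralisedElliptic.integral_starEntry (h : IsGeneralisedElliptic P a ρ) (n : ℕ)
    (ε : Bool) (x y : Fin n) : ∫ ω, starEntry (a n ω) ε x y ∂P n = 0 := by
  unfold starEntry
  split_ifs
  · exact h.mean_zero n y x
  · exact h.mean_zero n x y

/-- An edge is crossed in opposite directions. Equal exponents then select the two opposite entries,
hence their correlation, while different exponents select the same entry twice, hence a variance. -/
lemma IsGeneralisedElliptic.integral_mul_starEntry (h : IsGeneralisedElliptic P a ρ) (n : ℕ)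
    (ε ε' : Bool) {x y : Fin n} (hxy : x ≠ y) :
    ∫ ω, starEntry (a n ω) ε x y * starEntry (a n ω) ε' y x ∂P n
      = ρ n (idxDist x y) ^ (if ε = ε' then 1 else 0) := by
  unfold starEntry
  cases ε <;> cases ε' <;> simp only [if_true, if_false, Bool.false_eq_true, reduceCtorEq,
    pow_one, pow_zero]
  · exact h.correlation n x y hxy
  · simp only [← pow_two]; exact h.variance_one n x y
  · simp only [← pow_two]; exact h.variance_one n y x
  · rw [← h.correlation n x y hxy]; simp only [mul_comm]

lemma IsGeneralisedElliptic.exists_bound (h : IsGeneralisedElliptic P a ρ) {p : ℕ} (hp : 0 < p) :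
    ∃ C : ℝ, ∀ (n : ℕ) (ε : Fin p → Bool) (i : Fin p → Fin n),
      Integrable (fun ω => ∏ r, starEntry (a n ω) (ε r) (i r) (i (finRotate p r))) (P n) ∧
      |walkExp (P n) (a n) ε i| ≤ C := by
  obtain ⟨C, hC⟩ := h.moments_bounded p
  have : Nonempty (Fin p) := ⟨⟨0, hp⟩⟩
  refine ⟨p * C, fun n ε i => ?_⟩
  have := integrable_prod_and_bound (P := P n) (C := C)
    (X := fun r ω => starEntry (a n ω) (ε r) (i r) (i (finRotate p r)))
    (fun r => measurable_starEntry (h.measurable n) _ _ _) (fun r => by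
      rw [Fintype.card_fin]
      unfold starEntry
      split_ifs
      · exact hC n _ _
      · exact hC n _ _)
  rwa [Fintype.card_fin] at this

/-- An edge which is used only once makes the expectation vanish. -/
lemma IsGeneralisedElliptic.walkExp_eq_zero [∀ n, IsProbabilityMeasure (P n)]
    (h : IsGeneralisedElliptic P a ρ) {n p : ℕ}
    (ε : Fin p → Bool) (i : Fin p → Fin n) (r : Fin p)
    (hr : ∀ s, cycEdge i s = cycEdge i r → s = r) : walkExp (P n) (a n) ε i = 0 := by
  rw [walkExp_eq_prod (h.measurable n) (h.indep n)]
  refine Finset.prod_eq_zero (Finset.mem_univ (sortedPair (i r) (i (finRotate p r)))) ?_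
  have : (Finset.univ.filter fun s => sortedPair (i s) (i (finRotate p s))
      = sortedPair (i r) (i (finRotate p r))) = {r} := by
    ext s
    simp only [Finset.mem_filter, Finset.mem_univ, true_and, Finset.mem_singleton,
      sortedPair_eq_iff]
    exact ⟨hr s, by rintro rfl; rfl⟩
  simp only [this, Finset.prod_singleton]
  exact h.integral_starEntry n _ _ _

/-- In the factorisation over edges, the times using a given edge form one block `{r, π r}`,
represented by its opener; unused edges contribute the empty product. -/
lemma IsGeneralisedElliptic.walkExp_eq_prod_corr [∀ n, IsProbabilityMeasure (P n)]
    (h : IsGeneralisedElliptic P a ρ) {n p : ℕ}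
    (ε : Fin p → Bool) {i : Fin p → Fin n} {π : Equiv.Perm (Fin p)} (hπ : IsTreePairing i π) :
    walkExp (P n) (a n) ε i = ∏ r : Fin p with r < π r,
      ρ n (idxDist (i r) (i (π r))) ^ (if ε r = ε (π r) then 1 else 0) := by
  set e : Fin p → {q : Fin n × Fin n // q.1 ≤ q.2} :=
    fun r => sortedPair (i r) (i (finRotate p r)) with he
  have heq : ∀ r s, e s = e r ↔ s = r ∨ s = π r := by
    intro r s
    rw [he]
    simp only [sortedPair_eq_iff]
    refine ⟨hπ.edge s r, ?_⟩
    rintro (rfl | rfl)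
    · rfl
    · exact hπ.compatible.cycEdge_eq hπ.pairing r
  rw [walkExp_eq_prod (h.measurable n) (h.indep n), ← Finset.prod_subset
    (Finset.subset_univ ((Finset.univ.filter fun r => r < π r).image e)), Finset.prod_image]
  · refine Finset.prod_congr rfl fun r _ => ?_
    have hfib : (Finset.univ.filter fun s => sortedPair (i s) (i (finRotate p s)) = e r)
        = {r, π r} := by
      ext s
      simp only [Finset.mem_filter, Finset.mem_univ, true_and, Finset.mem_insert,
        Finset.mem_singleton]
      exact heq r s
    simp only [hfib, Finset.prod_pair (hπ.pairing.fixedPointFree r).symm]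
    rw [hπ.compatible r, hπ.compatible.apply_pairing hπ.pairing]
    exact h.integral_mul_starEntry n _ _ (hπ.loopless r)
  · intro r hr s hs hrs
    simp only [Finset.coe_filter, Finset.mem_univ, true_and, Set.mem_ofPred_eq] at hr hs
    rcases (heq s r).1 hrs with h' | h'
    · exact h'
    · rw [h', hπ.pairing.involutive] at hr
      exact absurd hs hr.not_gt
  · intro q _ hq
    rw [Finset.filter_false_of_mem]
    · simp
    · rintro r - rfl
      refine hq (Finset.mem_image.2 ?_)
      rcases lt_or_gt_of_ne (hπ.pairing.fixedPointFree r) with hr | hr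
      · refine ⟨π r, ?_, (heq r _).2 (Or.inr rfl)⟩
        simpa [hπ.pairing.involutive] using hr
      · exact ⟨r, by simpa using hr, rfl⟩

lemma IsGeneralisedElliptic.expTrace_starWord (h : IsGeneralisedElliptic P a ρ) (n : ℕ) {p : ℕ}
    (hp : 0 < p) (ε : Fin p → Bool) :
    expTrace (P n) (starWord (scaled (a n)) ε)
      = ((1 / (n : ℝ) * (√(n : ℝ))⁻¹ ^ p *
          ∑ i : Fin p → Fin n, walkExp (P n) (a n) ε i : ℝ) : ℂ) := by
  obtain ⟨C, hC⟩ := h.exists_bound hp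
  rw [expTrace]
  simp_rw [trace_starWord_scaled hp]
  rw [integral_complex_ofReal, integral_const_mul,
    integral_finsetSum _ fun i _ => (hC n ε i).1]
  simp only [walkExp]
  push_cast
  ring

end Elliptic

/-! ## Asymptotics of the moments -/

section Asymptotics

lemma inv_sqrt_pow_two_mul (n k : ℕ) :
    1 / (n : ℝ) * (√(n : ℝ))⁻¹ ^ (2 * k) = 1 / (n : ℝ) ^ (k + 1) := by
  rw [pow_mul, inv_pow, Real.sq_sqrt (Nat.cast_nonneg n), inv_pow, pow_succ]
  field_simp

/-- In powers of `√n` the exponents are `-2 - p + 2 * v ≤ -1`. -/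
lemma normalisation_mul_pow_le {n p v : ℕ} (hn : 0 < n) (hv : 2 * v ≤ p + 1) :
    1 / (n : ℝ) * (√(n : ℝ))⁻¹ ^ p * (n : ℝ) ^ v ≤ (√(n : ℝ))⁻¹ := by
  have hs : 1 ≤ √(n : ℝ) := Real.one_le_sqrt.2 (by exact_mod_cast hn)
  have hs0 : 0 < √(n : ℝ) := by linarith
  have hsq : (n : ℝ) = √(n : ℝ) ^ 2 := (Real.sq_sqrt (Nat.cast_nonneg n)).symm
  have h1 : (n : ℝ) ^ v ≤ √(n : ℝ) ^ (p + 1) := by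
    conv_lhs => rw [hsq, ← pow_mul]
    exact pow_le_pow_right₀ hs hv
  calc 1 / (n : ℝ) * (√(n : ℝ))⁻¹ ^ p * (n : ℝ) ^ v
      ≤ 1 / (n : ℝ) * (√(n : ℝ))⁻¹ ^ p * √(n : ℝ) ^ (p + 1) := by gcongr
    _ = (√(n : ℝ))⁻¹ := by
        conv_lhs => rw [hsq, Real.sqrt_sq hs0.le]
        rw [inv_pow]
        field_simp
        ring

/-- Closed walks with few vertices do not contribute to the limit. -/
lemma tendsto_sum_few_labels {p : ℕ} (hp : 0 < p) (g : ∀ n, (Fin p → Fin n) → ℝ) {K : ℝ}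
    (hK : ∀ n i, |g n i| ≤ K)
    (hg : ∀ n i, p + 2 ≤ 2 * (Finset.univ.image i).card → g n i = 0) :
    Tendsto (fun n : ℕ => 1 / (n : ℝ) * (√(n : ℝ))⁻¹ ^ p * ∑ i, g n i) atTop (𝓝 0) := by
  -- The largest number of labels not excluded by `p + 2 ≤ 2 * card`.
  set v := (p + 1) / 2 with hv
  -- A labelling exists only for positive `n`, whence the choice `n = 1`.
  have hK0 : 0 ≤ K := (abs_nonneg _).trans (hK 1 fun _ => 0)
  have hbound : ∀ n, |∑ i, g n i| ≤ K * ((v : ℝ) ^ p * (n : ℝ) ^ v) := by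
    intro n
    have hsum : ∑ i, g n i
        = ∑ i : Fin p → Fin n with (Finset.univ.image i).card ≤ v, g n i := by
      rw [Finset.sum_filter]
      refine Finset.sum_congr rfl fun i _ => ?_
      split_ifs with h
      · rfl
      · exact hg n i (by omega)
    rw [hsum]
    refine (Finset.abs_sum_le_sum_abs _ _).trans
      ((Finset.sum_le_card_nsmul _ _ K fun i _ => hK n i).trans ?_)
    rw [nsmul_eq_mul, mul_comm]
    refine mul_le_mul_of_nonneg_left ?_ hK0
    exact_mod_cast card_few_labels p n v hp
  have hlim : Tendsto (fun n : ℕ => K * (v : ℝ) ^ p * (√(n : ℝ))⁻¹) atTop (𝓝 0) := by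
    have : Tendsto (fun n : ℕ => (√(n : ℝ))⁻¹) atTop (𝓝 0) :=
      tendsto_inv_atTop_zero.comp (Real.tendsto_sqrt_atTop.comp tendsto_natCast_atTop_atTop)
    simpa using this.const_mul (K * (v : ℝ) ^ p)
  refine squeeze_zero_norm' ?_ hlim
  filter_upwards [eventually_gt_atTop 0] with n hn
  rw [Real.norm_eq_abs, abs_mul, abs_of_nonneg (by positivity)]
  calc 1 / (n : ℝ) * (√(n : ℝ))⁻¹ ^ p * |∑ i, g n i|
      ≤ 1 / (n : ℝ) * (√(n : ℝ))⁻¹ ^ p * (K * ((v : ℝ) ^ p * (n : ℝ) ^ v)) := by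
        gcongr; exact hbound n
    _ = K * (v : ℝ) ^ p * (1 / (n : ℝ) * (√(n : ℝ))⁻¹ ^ p * (n : ℝ) ^ v) := by ring
    _ ≤ K * (v : ℝ) ^ p * (√(n : ℝ))⁻¹ := by
        gcongr
        exact normalisation_mul_pow_le hn (by omega)

/-- The product of the correlations over the blocks of a pairing. -/
def corrTerm (d : ℕ → ℝ) {n p : ℕ} (ε : Fin p → Bool) (π : Equiv.Perm (Fin p))
    (i : Fin p → Fin n) : ℝ :=
  ∏ r : Fin p with r < π r, d (idxDist (i r) (i (π r))) ^ (if ε r = ε (π r) then 1 else 0)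

open Classical in
-- The two Kronecker deltas of a block express compatibility at its two ends, so together they are
-- the indicator of `Compatible`.
lemma corrSum_eq (d : ℕ → ℝ) (n k : ℕ) (ε : Fin (2 * k) → Bool) {π : Equiv.Perm (Fin (2 * k))}
    (hπ : IsNCPairing π) :
    corrSum d n k ε π = 1 / (n : ℝ) * (√(n : ℝ))⁻¹ ^ (2 * k) *
      ∑ i : Fin (2 * k) → Fin n, if Compatible π i then corrTerm d ε π i else 0 := by
  rw [inv_sqrt_pow_two_mul, corrSum]
  congr 1
  refine Finset.sum_congr rfl fun i _ => ?_
  split_ifs with h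
  · refine Finset.prod_congr rfl fun r _ => ?_
    rw [if_pos (h r).symm, if_pos (h.apply_pairing hπ r), mul_one, mul_one]
  · obtain ⟨r, hr⟩ := not_forall.1 h
    have hr' : ¬ i r = i (finRotate (2 * k) (π r)) := fun h' => hr h'.symm
    rcases lt_or_gt_of_ne (hπ.fixedPointFree r) with hlt | hlt
    · refine Finset.prod_eq_zero (i := π r) (by simpa [hπ.involutive] using hlt) ?_
      rw [hπ.involutive]
      simp only [if_neg hr', mul_zero]
    · refine Finset.prod_eq_zero (i := r) (by simpa using hlt) ?_
      simp only [if_neg hr', mul_zero, zero_mul]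

lemma idxDist_lt {n : ℕ} (x y : Fin n) : idxDist x y < n := by
  unfold idxDist; omega

lemma idxDist_pos {n : ℕ} {x y : Fin n} (h : x ≠ y) : 1 ≤ idxDist x y := by
  have : (x : ℕ) ≠ y := fun h' => h (Fin.ext h')
  unfold idxDist; omega

lemma abs_corrTerm_le {d : ℕ → ℝ} {n p : ℕ} {B : ℝ} (hB : 1 ≤ B) (hd : ∀ j < n, |d j| ≤ B)
    (ε : Fin p → Bool) (π : Equiv.Perm (Fin p)) (i : Fin p → Fin n) :
    |corrTerm d ε π i| ≤ B ^ p := by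
  rw [corrTerm, Finset.abs_prod]
  refine (Finset.prod_le_prod (g := fun _ => B) (fun _ _ => abs_nonneg _) fun r _ => ?_).trans ?_
  · split_ifs
    · rw [pow_one]; exact hd _ (idxDist_lt _ _)
    · simpa using hB
  · rw [Finset.prod_const]
    refine pow_le_pow_right₀ hB ((Finset.card_le_univ _).trans (by simp))

variable {Ω : ℕ → Type*} [∀ n, MeasurableSpace (Ω n)] {P : ∀ n, Measure (Ω n)}
  {a : ∀ n, Ω n → Matrix (Fin n) (Fin n) ℝ} {ρ : ℕ → ℕ → ℝ}

lemma IsGeneralisedElliptic.integrable_sq (h : IsGeneralisedElliptic P a ρ) (n : ℕ)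
    (x y : Fin n) : Integrable (fun ω => a n ω x y ^ 2) (P n) := by
  obtain ⟨C, hC⟩ := h.moments_bounded 2
  simpa only [sq_abs] using (hC n x y).1

/-- The Cauchy–Schwarz inequality for the correlations. -/
lemma IsGeneralisedElliptic.abs_corr_le_one (h : IsGeneralisedElliptic P a ρ) {n d : ℕ}
    (hd : 1 ≤ d) (hdn : d < n) : |ρ n d| ≤ 1 := by
  set x : Fin n := ⟨d, hdn⟩
  set y : Fin n := ⟨0, by omega⟩
  have hxy : x ≠ y := fun h => by have := congrArg Fin.val h; simp [x, y] at this; omega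
  have hdist : idxDist x y = d := by simp [idxDist, x, y]
  rw [← hdist, ← h.correlation n x y hxy]
  have hint : Integrable (fun ω => (a n ω x y ^ 2 + a n ω y x ^ 2) / 2) (P n) :=
    ((h.integrable_sq n x y).add (h.integrable_sq n y x)).div_const 2
  refine (norm_integral_le_of_norm_le (f := fun ω => a n ω x y * a n ω y x) hint
    (Eventually.of_forall fun ω => ?_)).trans ?_
  · rw [Real.norm_eq_abs, abs_mul]
    nlinarith [sq_nonneg (|a n ω x y| - |a n ω y x|), sq_abs (a n ω x y), sq_abs (a n ω y x)]
  · rw [integral_div, integral_add (h.integrable_sq n x y) (h.integrable_sq n y x),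
      h.variance_one, h.variance_one]
    norm_num

/-- Cauchy–Schwarz covers positive distances. Distance `0` occurs in `corrSum` when a compatible
labelling has a loop, and there the assumed bound on `ρ n 0` is needed. -/
lemma IsGeneralisedElliptic.exists_corr_bound (h : IsGeneralisedElliptic P a ρ) :
    ∃ B : ℝ, 1 ≤ B ∧ ∀ n, ∀ j < n, |ρ n j| ≤ B := by
  obtain ⟨C, hC⟩ := h.bounded_zero
  refine ⟨max 1 C, le_max_left _ _, fun n j hj => ?_⟩
  obtain rfl | hj0 := Nat.eq_zero_or_pos j
  · exact (hC n).trans (le_max_right _ _)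
  · exact (h.abs_corr_le_one hj0 hj).trans (le_max_left _ _)

lemma IsGeneralisedElliptic.exists_tree_of_walkExp_ne_zero [∀ n, IsProbabilityMeasure (P n)]
    (h : IsGeneralisedElliptic P a ρ) {n p : ℕ} (hp : 0 < p) (ε : Fin p → Bool)
    {i : Fin p → Fin n} (hne : walkExp (P n) (a n) ε i ≠ 0)
    (hi : p + 2 ≤ 2 * (Finset.univ.image i).card) : Even p ∧ ∃ π, IsTreePairing i π := by
  have hedge : ∀ r, ∃ s, s ≠ r ∧ cycEdge i s = cycEdge i r := by
    by_contra! hcon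
    obtain ⟨r, hr⟩ := hcon
    exact hne (h.walkExp_eq_zero ε i r fun s hs => by
      by_contra hsr; exact hr s hsr hs)
  obtain ⟨h1, -, h2⟩ := exists_isTreePairing hp i hedge hi
  exact ⟨h1, h2⟩

/-- The odd moments tend to zero. -/
theorem IsGeneralisedElliptic.tendsto_expTrace_odd [∀ n, IsProbabilityMeasure (P n)]
    (h : IsGeneralisedElliptic P a ρ) {p : ℕ} (hp : Odd p) (ε : Fin p → Bool) :
    Tendsto (fun n => expTrace (P n) (starWord (scaled (a n)) ε)) atTop (𝓝 0) := by
  obtain ⟨C, hC⟩ := h.exists_bound hp.pos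
  simp_rw [h.expTrace_starWord _ hp.pos]
  rw [← Complex.ofReal_zero]
  refine (Complex.continuous_ofReal.tendsto 0).comp (tendsto_sum_few_labels hp.pos
    (fun n i => walkExp (P n) (a n) ε i) (fun n i => (hC n ε i).2) fun n i hi => ?_)
  by_contra hne
  exact Nat.not_even_iff_odd.2 hp (h.exists_tree_of_walkExp_ne_zero hp.pos ε hne hi).1

open Classical in
/-- The even moments are asymptotically given by sums over non-crossing pairings. -/
theorem IsGeneralisedElliptic.tendsto_expTrace_sub [∀ n, IsProbabilityMeasure (P n)]
    (h : IsGeneralisedElliptic P a ρ) {k : ℕ} (hk : 0 < k) (ε : Fin (2 * k) → Bool) :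
    Tendsto (fun n => expTrace (P n) (starWord (scaled (a n)) ε)
      - ((∑ π : Equiv.Perm (Fin (2 * k)) with IsNCPairing π, corrSum (ρ n) n k ε π : ℝ) : ℂ))
      atTop (𝓝 0) := by
  have hp : 0 < 2 * k := by omega
  obtain ⟨C, hC⟩ := h.exists_bound hp
  obtain ⟨B, hB, hρ⟩ := h.exists_corr_bound
  have hB0 : 0 ≤ B ^ (2 * k) := by positivity
  set N : Finset (Equiv.Perm (Fin (2 * k))) := Finset.univ.filter fun π => IsNCPairing π with hN
  have hmem : ∀ {π}, π ∈ N ↔ IsNCPairing π := by simp [hN]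
  -- The difference vanishes on walks with many vertices: a tree walk is compatible with exactly one
  -- non-crossing pairing, with matching term, and any other such walk has zero expectation and no
  -- compatible pairing.
  have key := tendsto_sum_few_labels hp
    (fun n i => walkExp (P n) (a n) ε i
      - ∑ π ∈ N, if Compatible π i then corrTerm (ρ n) ε π i else 0)
    (K := C + N.card • B ^ (2 * k)) (fun n i => ?_) (fun n i hi => ?_)
  · rw [← Complex.ofReal_zero]
    refine Tendsto.congr (fun n => ?_) ((Complex.continuous_ofReal.tendsto 0).comp key)
    rw [h.expTrace_starWord n hp, ← Complex.ofReal_sub, Function.comp_apply]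
    congr 1
    rw [Finset.sum_sub_distrib, mul_sub, Finset.sum_comm, Finset.mul_sum N]
    congr 1
    exact Finset.sum_congr rfl fun π hπ => (corrSum_eq _ _ _ _ (hmem.1 hπ)).symm
  · refine (abs_sub _ _).trans (add_le_add (hC n ε i).2
      ((Finset.abs_sum_le_sum_abs _ _).trans (Finset.sum_le_card_nsmul _ _ _ fun π _ => ?_)))
    split_ifs
    · exact abs_corrTerm_le hB (hρ n) ε π i
    · simpa using hB0
  · rw [sub_eq_zero]
    by_cases htree : ∃ π, IsTreePairing i π
    · obtain ⟨π, hπ⟩ := htree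
      rw [h.walkExp_eq_prod_corr ε hπ, Finset.sum_eq_single_of_mem π (hmem.2 hπ.pairing),
        if_pos hπ.compatible]
      · rfl
      · intro π' hπ' hne
        exact if_neg fun hc => hne (hπ.eq (hmem.1 hπ') hc)
    · rw [Finset.sum_eq_zero]
      · by_contra hne
        exact htree (h.exists_tree_of_walkExp_ne_zero hp ε hne hi).2
      · intro π hπ
        exact if_neg fun hc => htree
          (exists_isTreePairing hp i (hc.exists_edge (hmem.1 hπ)) hi).2.2

lemma tendsto_expTrace_zero [∀ n, IsProbabilityMeasure (P n)] (ε : Fin 0 → Bool) :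
    Tendsto (fun n => expTrace (P n) (starWord (scaled (a n)) ε)) atTop (𝓝 1) := by
  refine tendsto_const_nhds.congr' ?_
  filter_upwards [eventually_gt_atTop 0] with n hn
  have hn' : (n : ℂ) ≠ 0 := by exact_mod_cast hn.ne'
  simp [expTrace, starWord, Matrix.trace_one, hn']

/-- The sums over a non-crossing pairing converge if the correlations are constant. -/
theorem IsGeneralisedElliptic.tendsto_corrSum (h : IsGeneralisedElliptic P a ρ) {r : ℝ}
    (hr : ∀ n i, 1 ≤ i → ρ n i = r) {k : ℕ} (hk : 0 < k) (ε : Fin (2 * k) → Bool)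
    {π : Equiv.Perm (Fin (2 * k))} (hπ : IsNCPairing π) :
    Tendsto (fun n => corrSum (ρ n) n k ε π) atTop
      (𝓝 (∏ s : Fin (2 * k) with s < π s, r ^ (if ε s = ε (π s) then 1 else 0))) := by
  classical
  have hp : 0 < 2 * k := by omega
  obtain ⟨B, hB, hρ⟩ := h.exists_corr_bound
  have hB0 : 0 ≤ B ^ (2 * k) := by positivity
  set L := ∏ s : Fin (2 * k) with s < π s, r ^ (if ε s = ε (π s) then 1 else 0) with hL
  -- A compatible labelling with many labels is a tree walk and has no loop, so `ρ n 0` does not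
  -- enter and its term is exactly `L`.
  have key := tendsto_sum_few_labels hp
    (fun n i => if Compatible π i then corrTerm (ρ n) ε π i - L else 0)
    (K := B ^ (2 * k) + |L|) (fun n i => ?_) (fun n i hi => ?_)
  · rw [← zero_add L]
    refine (key.add_const L).congr' ?_
    filter_upwards [eventually_gt_atTop 0] with n hn
    have hn' : (n : ℝ) ≠ 0 := by exact_mod_cast hn.ne'
    have hcount : ∑ i : Fin (2 * k) → Fin n, (if Compatible π i then L else 0)
        = (n : ℝ) ^ (k + 1) * L := by
      rw [← Finset.sum_filter, Finset.sum_const, card_compatible hk hπ, nsmul_eq_mul]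
      push_cast
      rfl
    have hsplit : ∑ i : Fin (2 * k) → Fin n,
        (if Compatible π i then corrTerm (ρ n) ε π i - L else 0)
          = ∑ i : Fin (2 * k) → Fin n, (if Compatible π i then corrTerm (ρ n) ε π i else 0)
            - (n : ℝ) ^ (k + 1) * L := by
      rw [← hcount, ← Finset.sum_sub_distrib]
      refine Finset.sum_congr rfl fun i _ => ?_
      split_ifs <;> simp
    rw [corrSum_eq _ _ _ _ hπ, hsplit, mul_sub, inv_sqrt_pow_two_mul]
    field_simp
    ring
  · split_ifs
    · exact (abs_sub _ _).trans (add_le_add (abs_corrTerm_le hB (hρ n) ε π i) le_rfl)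
    · simp only [abs_zero]; positivity
  · split_ifs with hc
    · obtain ⟨π', hπ'⟩ := (exists_isTreePairing hp i (hc.exists_edge hπ) hi).2.2
      rw [sub_eq_zero, corrTerm, hL]
      refine Finset.prod_congr rfl fun s _ => ?_
      rw [hr n _ (idxDist_pos _)]
      rw [hc.apply_pairing hπ]
      exact hπ'.loopless s
    · rfl

theorem IsGeneralisedElliptic.limitCondition (h : IsGeneralisedElliptic P a ρ) {r : ℝ}
    (hr : ∀ n i, 1 ≤ i → ρ n i = r) : LimitCondition ρ := by
  intro k ε π hπ
  obtain rfl | hk := Nat.eq_zero_or_pos k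
  -- For `k = 0` only the empty labelling remains and the sum is `1 / n`, although the moment of the
  -- empty word tends to `1`; this is why length zero is treated apart.
  · refine ⟨0, ?_⟩
    have : ∀ n : ℕ, corrSum (ρ n) n 0 ε π = (n : ℝ)⁻¹ := by
      intro n
      simp [corrSum]
    simp_rw [this]
    exact tendsto_inv_atTop_zero.comp tendsto_natCast_atTop_atTop
  · exact ⟨_, h.tendsto_corrSum hr hk ε hπ⟩

/-- Under the limit condition all the moments converge. -/
theorem IsGeneralisedElliptic.exists_limit [∀ n, IsProbabilityMeasure (P n)]
    (h : IsGeneralisedElliptic P a ρ) (hL : LimitCondition ρ) {p : ℕ} (ε : Fin p → Bool) :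
    ∃ L : ℂ, Tendsto (fun n => expTrace (P n) (starWord (scaled (a n)) ε)) atTop (𝓝 L) := by
  classical
  rcases Nat.even_or_odd p with hp | hp
  · obtain ⟨k, rfl⟩ := hp.two_dvd
    obtain rfl | hk := Nat.eq_zero_or_pos k
    · exact ⟨1, tendsto_expTrace_zero ε⟩
    -- The value `0` for other permutations is a default that makes the choice of limits total.
    · have hex : ∀ π : Equiv.Perm (Fin (2 * k)), ∃ L : ℝ, IsNCPairing π →
          Tendsto (fun n => corrSum (ρ n) n k ε π) atTop (𝓝 L) := fun π => by
        by_cases hπ : IsNCPairing π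
        · obtain ⟨L, hL⟩ := hL k ε π hπ
          exact ⟨L, fun _ => hL⟩
        · exact ⟨0, fun h => absurd h hπ⟩
      choose L hL using hex
      have hsum := tendsto_finsetSum
        (Finset.univ.filter fun π : Equiv.Perm (Fin (2 * k)) => IsNCPairing π)
        fun π hπ => hL π (Finset.mem_filter.1 hπ).2
      have := (h.tendsto_expTrace_sub hk ε).add
        ((Complex.continuous_ofReal.tendsto _).comp hsum)
      exact ⟨_, this.congr fun n => by simp⟩
  · exact ⟨0, h.tendsto_expTrace_odd hp ε⟩

/-- If the correlations are constant, then the limits of the moments are sums over non-crossing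
pairings. -/
theorem IsGeneralisedElliptic.tendsto_wickSum [∀ n, IsProbabilityMeasure (P n)]
    (h : IsGeneralisedElliptic P a ρ) {r : ℝ} (hr : ∀ n i, 1 ≤ i → ρ n i = r) {p : ℕ}
    (ε : Fin p → Bool) :
    Tendsto (fun n => expTrace (P n) (starWord (scaled (a n)) ε)) atTop
      (𝓝 (wickSum (fun x y => if x = y then (r : ℂ) else 1) (List.ofFn ε).reverse [])) := by
  classical
  rcases Nat.even_or_odd p with hp | hp
  · obtain ⟨k, rfl⟩ := hp.two_dvd
    obtain rfl | hk := Nat.eq_zero_or_pos k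
    · simpa [wickSum] using tendsto_expTrace_zero (P := P) (a := a) ε
    · rw [← sum_ncPairings]
      have hsum := tendsto_finsetSum
        (Finset.univ.filter fun π : Equiv.Perm (Fin (2 * k)) => IsNCPairing π)
        fun π hπ => h.tendsto_corrSum hr hk ε (Finset.mem_filter.1 hπ).2
      have := (h.tendsto_expTrace_sub hk ε).add
        ((Complex.continuous_ofReal.tendsto _).comp hsum)
      refine (this.congr fun n => by simp).trans_eq ?_
      rw [zero_add, Complex.ofReal_sum]
      congr 1
      refine Finset.sum_congr rfl fun π _ => ?_
      rw [Complex.ofReal_prod]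
      refine Finset.prod_congr rfl fun s _ => ?_
      split_ifs <;> simp
  · rw [wickSum_eq_zero_of_odd _ _ _ (by simpa using hp)]
    exact h.tendsto_expTrace_odd hp ε

end Asymptotics

/-! ## The universal `*`-algebra with one generator -/

section StarPolynomials

/-- The `*`-algebra of non-commutative polynomials in one variable `x` and its adjoint; the letter
`false` stands for `x` and `true` for its adjoint. -/
abbrev StarPoly : Type := MonoidAlgebra ℂ (FreeMonoid Bool)

namespace StarPoly

/-- A word, as a polynomial. -/
def word : FreeMonoid Bool →* StarPoly := MonoidAlgebra.of ℂ (FreeMonoid Bool)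

lemma induction {motive : StarPoly → Prop} (x : StarPoly) (hword : ∀ w, motive (word w))
    (hadd : ∀ x y, motive x → motive y → motive (x + y))
    (hsmul : ∀ (c : ℂ) x, motive x → motive (c • x)) : motive x :=
  MonoidAlgebra.induction_on x hword hadd hsmul

/-- The involution on words, as a homomorphism to the opposite algebra. -/
def starWordHom : FreeMonoid Bool →* StarPolyᵐᵒᵖ :=
  FreeMonoid.lift fun b => MulOpposite.op (word (FreeMonoid.of (!b)))

lemma commute_starWordHom (c : ℂ) (w : FreeMonoid Bool) :
    Commute (((algebraMap ℂ StarPolyᵐᵒᵖ).comp (starRingEnd ℂ)) c) (starWordHom w) :=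
  Algebra.commutes (starRingEnd ℂ c) _

/-- The involution, as a ring homomorphism to the opposite algebra. -/
def starHom : StarPoly →+* StarPolyᵐᵒᵖ :=
  MonoidAlgebra.liftNCRingHom ((algebraMap ℂ StarPolyᵐᵒᵖ).comp (starRingEnd ℂ)) starWordHom
    commute_starWordHom

lemma starHom_single (w : FreeMonoid Bool) (c : ℂ) :
    starHom (MonoidAlgebra.single w c)
      = algebraMap ℂ StarPolyᵐᵒᵖ (starRingEnd ℂ c) * starWordHom w :=
  MonoidAlgebra.liftNCRingHom_single _ _ _ _ _

lemma starHom_word (w : FreeMonoid Bool) : starHom (word w) = starWordHom w := by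
  rw [show word w = MonoidAlgebra.single w 1 from rfl, starHom_single, map_one, map_one, one_mul]

lemma starHom_smul (c : ℂ) (x : StarPoly) :
    starHom (c • x) = (starRingEnd ℂ c) • starHom x := by
  have : starHom (algebraMap ℂ StarPoly c) = algebraMap ℂ StarPolyᵐᵒᵖ (starRingEnd ℂ c) := by
    rw [show algebraMap ℂ StarPoly c = MonoidAlgebra.single 1 c from rfl, starHom_single, map_one,
      mul_one]
  rw [Algebra.smul_def, map_mul, this, Algebra.smul_def]

instance : Star StarPoly := ⟨fun x => (starHom x).unop⟩

lemma star_def (x : StarPoly) : star x = (starHom x).unop := rfl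

lemma star_letter (b : Bool) : star (word (FreeMonoid.of b)) = word (FreeMonoid.of (!b)) := by
  rw [star_def, starHom_word, starWordHom, FreeMonoid.lift_eval_of, MulOpposite.unop_op]

lemma star_smul' (c : ℂ) (x : StarPoly) : star (c • x) = (starRingEnd ℂ c) • star x := by
  rw [star_def, starHom_smul]; rfl

lemma star_add' (x y : StarPoly) : star (x + y) = star x + star y := by
  rw [star_def, map_add]; rfl

lemma star_mul' (x y : StarPoly) : star (x * y) = star y * star x := by
  rw [star_def, map_mul]; rfl

lemma star_one' : star (1 : StarPoly) = 1 := by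
  rw [star_def, map_one]; rfl

instance : StarRing StarPoly where
  star_involutive x := by
    refine induction (motive := fun x => star (star x) = x) x (fun w => ?_) (fun x y hx hy => ?_) fun c x hx => ?_
    · induction w using FreeMonoid.recOn with
      | one => rw [map_one, star_one', star_one']
      | of_mul b w ih => rw [map_mul, star_mul', star_mul', ih, star_letter, star_letter, Bool.not_not]
    · rw [star_add', star_add', hx, hy]
    · rw [star_smul', star_smul', hx, Complex.conj_conj]
  star_mul := star_mul'
  star_add := star_add'

instance : StarModule ℂ StarPoly := ⟨star_smul'⟩

variable {B : Type*} [Ring B] [StarRing B] [Algebra ℂ B]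

/-- The evaluation of a polynomial at an element of a `*`-algebra. -/
def eval (b : B) : StarPoly →ₐ[ℂ] B :=
  MonoidAlgebra.lift ℂ B (FreeMonoid Bool) (FreeMonoid.lift fun ε => if ε then star b else b)

lemma eval_word (b : B) (w : FreeMonoid Bool) :
    eval b (word w) = FreeMonoid.lift (fun ε => if ε then star b else b) w :=
  MonoidAlgebra.lift_of _ _

lemma eval_star [StarModule ℂ B] (b : B) (x : StarPoly) : eval b (star x) = star (eval b x) := by
  refine induction (motive := fun x => eval b (star x) = star (eval b x)) x (fun w => ?_) (fun x y hx hy => ?_) fun c x hx => ?_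
  · induction w using FreeMonoid.recOn with
    | one => simp
    | of_mul ε w ih =>
      rw [map_mul, star_mul, map_mul, ih, map_mul, star_mul, star_letter, eval_word b (FreeMonoid.of _),
        eval_word b (FreeMonoid.of _), FreeMonoid.lift_eval_of, FreeMonoid.lift_eval_of]
      cases ε <;> simp
  · rw [star_add, map_add, hx, hy, map_add, star_add]
  · rw [star_smul, map_smul, hx, map_smul, star_smul]

lemma eval_ofList (b : B) {p : ℕ} (ε : Fin p → Bool) :
    eval b (word (FreeMonoid.ofList (List.ofFn ε))) = starWord b ε := by
  rw [eval_word, FreeMonoid.lift_ofList, List.map_ofFn, starWord]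
  rfl

lemma starWord_generator {p : ℕ} (ε : Fin p → Bool) :
    starWord (word (FreeMonoid.of false)) ε = word (FreeMonoid.ofList (List.ofFn ε)) := by
  rw [← eval_ofList, eval_word]
  have : FreeMonoid.lift (fun ε => if ε = true then star (word (FreeMonoid.of false))
      else word (FreeMonoid.of false)) = word := by
    apply FreeMonoid.hom_eq
    intro ε
    rw [FreeMonoid.lift_eval_of, star_letter]
    cases ε <;> rfl
  rw [this]

end StarPoly

end StarPolynomials

/-! ## Existence of the limit -/

section Limit

lemma trace_conjTranspose_mul {n : ℕ} (Y : Matrix (Fin n) (Fin n) ℂ) :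
    (star Y * Y).trace = ((∑ x, ∑ y, Complex.normSq (Y y x) : ℝ) : ℂ) := by
  rw [Matrix.trace, Complex.ofReal_sum]
  refine Finset.sum_congr rfl fun x _ => ?_
  rw [Matrix.diag_apply, Matrix.mul_apply, Complex.ofReal_sum]
  refine Finset.sum_congr rfl fun y _ => ?_
  rw [Complex.normSq_eq_conj_mul_self]
  rfl

/-- The trace is pointwise a sum of squared moduli. No integrability is needed, since the default
value of a divergent integral is `0`. -/
lemma expTrace_star_mul_self {n : ℕ} {Ω : Type*} [MeasurableSpace Ω] (P : Measure Ω)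
    (X : Ω → Matrix (Fin n) (Fin n) ℂ) :
    ∃ y : ℝ, 0 ≤ y ∧ expTrace P (star X * X) = y := by
  refine ⟨1 / (n : ℝ) * ∫ ω, ∑ x, ∑ y, Complex.normSq (X ω y x) ∂P, ?_, ?_⟩
  · refine mul_nonneg (by positivity) (integral_nonneg fun ω => ?_)
    exact Finset.sum_nonneg fun x _ => Finset.sum_nonneg fun y _ => Complex.normSq_nonneg _
  · rw [expTrace]
    have : ∀ ω, ((star X * X) ω).trace
        = ((∑ x, ∑ y, Complex.normSq (X ω y x) : ℝ) : ℂ) := fun ω =>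
      trace_conjTranspose_mul (X ω)
    simp_rw [this]
    rw [integral_complex_ofReal]
    push_cast
    rfl

variable {Ω : ℕ → Type*} [∀ n, MeasurableSpace (Ω n)] {P : ∀ n, Measure (Ω n)}
  {X : ∀ n, Ω n → Matrix (Fin n) (Fin n) ℂ}

/-- Random matrices whose moments exist and converge have a limit in `*`-distribution. -/
theorem exists_limit_of_moments
    (hint : ∀ n (p : ℕ) (ε : Fin p → Bool),
      Integrable (fun ω => (starWord (X n) ε ω).trace) (P n))
    (hlim : ∀ (p : ℕ) (ε : Fin p → Bool), ∃ L : ℂ,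
      Tendsto (fun n => expTrace (P n) (starWord (X n) ε)) atTop (𝓝 L))
    (hone : ∀ ε : Fin 0 → Bool,
      Tendsto (fun n => expTrace (P n) (starWord (X n) ε)) atTop (𝓝 1)) :
    ∃ (φ : StarPoly →ₗ[ℂ] ℂ) (x : StarPoly), IsState φ ∧ ConvergesInStarDist P X φ x := by
  have hword : ∀ w : FreeMonoid Bool, w = FreeMonoid.ofList (List.ofFn (FreeMonoid.toList w).get) :=
    fun w => by rw [List.ofFn_get]; rfl
  have hadd : ∀ n (x y : StarPoly) ω, (StarPoly.eval (X n) (x + y) ω).trace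
      = (StarPoly.eval (X n) x ω).trace + (StarPoly.eval (X n) y ω).trace := fun n x y ω => by
    rw [map_add, Pi.add_apply, Matrix.trace_add]
  have hsmul : ∀ n (c : ℂ) (x : StarPoly) ω, (StarPoly.eval (X n) (c • x) ω).trace
      = c * (StarPoly.eval (X n) x ω).trace := fun n c x ω => by
    rw [map_smul, Pi.smul_apply, Matrix.trace_smul, smul_eq_mul]
  have hI : ∀ n (x : StarPoly),
      Integrable (fun ω => (StarPoly.eval (X n) x ω).trace) (P n) := by
    intro n x
    refine StarPoly.induction (motive := fun x => Integrable (fun ω => (StarPoly.eval (X n) x ω).trace) (P n)) x (fun w => ?_) (fun x y hx hy => ?_) fun c x hx => ?_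
    · rw [hword w, StarPoly.eval_ofList]
      exact hint n _ _
    · simp_rw [hadd]; exact hx.add hy
    · simp_rw [hsmul]; exact hx.const_mul c
  have hEadd : ∀ n (x y : StarPoly), expTrace (P n) (StarPoly.eval (X n) (x + y))
      = expTrace (P n) (StarPoly.eval (X n) x) + expTrace (P n) (StarPoly.eval (X n) y) := by
    intro n x y
    simp_rw [expTrace, hadd]
    rw [integral_add (hI n x) (hI n y), mul_add]
  have hEsmul : ∀ n (c : ℂ) (x : StarPoly), expTrace (P n) (StarPoly.eval (X n) (c • x))
      = c * expTrace (P n) (StarPoly.eval (X n) x) := by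
    intro n c x
    simp_rw [expTrace, hsmul]
    rw [integral_const_mul]
    ring
  have hL : ∀ x : StarPoly, ∃ L : ℂ,
      Tendsto (fun n => expTrace (P n) (StarPoly.eval (X n) x)) atTop (𝓝 L) := by
    intro x
    refine StarPoly.induction (motive := fun x => ∃ L : ℂ,
      Tendsto (fun n => expTrace (P n) (StarPoly.eval (X n) x)) atTop (𝓝 L)) x (fun w => ?_) (fun x y hx hy => ?_) fun c x hx => ?_
    · rw [hword w]
      simp_rw [StarPoly.eval_ofList]
      exact hlim _ _
    · obtain ⟨L, hL⟩ := hx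
      obtain ⟨L', hL'⟩ := hy
      exact ⟨L + L', by simp_rw [hEadd]; exact hL.add hL'⟩
    · obtain ⟨L, hL⟩ := hx
      exact ⟨c * L, by simp_rw [hEsmul]; exact hL.const_mul c⟩
  choose L hL using hL
  -- The non-negative reals are closed in `ℂ`, and evaluation respects the involution, so positivity
  -- passes to the limit.
  have hpos : ∀ x : StarPoly, 0 ≤ (L (star x * x)).re ∧ (L (star x * x)).im = 0 := by
    intro x
    have hcl : IsClosed {z : ℂ | 0 ≤ z.re ∧ z.im = 0} :=
      (isClosed_le continuous_const Complex.continuous_re).inter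
        (isClosed_eq Complex.continuous_im continuous_const)
    refine hcl.mem_of_tendsto (hL (star x * x)) (Eventually.of_forall fun n => ?_)
    rw [map_mul, StarPoly.eval_star]
    obtain ⟨y, hy, h⟩ := expTrace_star_mul_self (P n) (StarPoly.eval (X n) x)
    rw [h]
    exact ⟨by simpa using hy, by simp⟩
  refine ⟨{ toFun := L, map_add' := fun x y => ?_, map_smul' := fun c x => ?_ },
    StarPoly.word (FreeMonoid.of false), ⟨?_, fun x => (hpos x).1, fun x => (hpos x).2⟩,
    fun p ε => ?_⟩
  · refine tendsto_nhds_unique (hL (x + y)) ?_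
    simp_rw [hEadd]
    exact (hL x).add (hL y)
  · refine tendsto_nhds_unique (hL (c • x)) ?_
    simp_rw [hEsmul]
    exact (hL x).const_mul c
  · refine tendsto_nhds_unique (hL 1) ?_
    simpa [starWord] using hone Fin.elim0
  · have := hL (StarPoly.word (FreeMonoid.ofList (List.ofFn ε)))
    simp_rw [StarPoly.eval_ofList] at this
    rw [StarPoly.starWord_generator]
    exact this

lemma IsGeneralisedElliptic.integrable_trace_starWord [∀ n, IsProbabilityMeasure (P n)]
    {a : ∀ n, Ω n → Matrix (Fin n) (Fin n) ℝ} {ρ : ℕ → ℕ → ℝ}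
    (h : IsGeneralisedElliptic P a ρ) (n : ℕ) {p : ℕ} (ε : Fin p → Bool) :
    Integrable (fun ω => (starWord (scaled (a n)) ε ω).trace) (P n) := by
  obtain rfl | hp := Nat.eq_zero_or_pos p
  · simp only [starWord, List.ofFn_zero, List.prod_nil, Pi.one_apply]
    exact integrable_const _
  · obtain ⟨C, hC⟩ := h.exists_bound hp
    simp_rw [trace_starWord_scaled hp]
    exact ((integrable_finsetSum _ fun i _ => (hC n ε i).1).const_mul _).ofReal

theorem IsGeneralisedElliptic.exists_limit_state [∀ n, IsProbabilityMeasure (P n)]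
    {a : ∀ n, Ω n → Matrix (Fin n) (Fin n) ℝ} {ρ : ℕ → ℕ → ℝ}
    (h : IsGeneralisedElliptic P a ρ) (hL : LimitCondition ρ) :
    ∃ (φ : StarPoly →ₗ[ℂ] ℂ) (x : StarPoly), IsState φ ∧
      ConvergesInStarDist P (fun n => scaled (a n)) φ x :=
  exists_limit_of_moments (fun n _ ε => h.integrable_trace_starWord n ε)
    (fun _ ε => h.exists_limit hL ε) tendsto_expTrace_zero

end Limit

/-! ## Semicircular elements and Chebyshev polynomials -/

section Semicircular

open Polynomial

/-- The rescaled Chebyshev polynomials of the second kind. -/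
def chebS (R : Type*) [CommRing R] (k : ℕ) : R[X] := Chebyshev.S R k

lemma chebS_zero (R : Type*) [CommRing R] : chebS R 0 = 1 := Chebyshev.S_zero R

lemma chebS_one (R : Type*) [CommRing R] : chebS R 1 = X := Chebyshev.S_one R

lemma chebS_add_two (R : Type*) [CommRing R] (k : ℕ) :
    chebS R (k + 2) = X * chebS R (k + 1) - chebS R k := by
  unfold chebS
  exact_mod_cast Chebyshev.S_add_two R k

/-- The three-term recurrence makes the span stable under multiplication by `X`, and it contains
`1`. -/
lemma span_chebS (R : Type*) [CommRing R] : Submodule.span R (Set.range (chebS R)) = ⊤ := by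
  have hX : ∀ p ∈ Submodule.span R (Set.range (chebS R)),
      X * p ∈ Submodule.span R (Set.range (chebS R)) := by
    intro p hp
    induction hp using Submodule.span_induction with
    | mem p hp =>
      obtain ⟨k, rfl⟩ := hp
      cases k with
      | zero =>
        rw [chebS_zero, mul_one, ← chebS_one]
        exact Submodule.subset_span ⟨1, rfl⟩
      | succ k =>
        rw [show X * chebS R (k + 1) = chebS R (k + 2) + chebS R k by rw [chebS_add_two]; ring]
        exact add_mem (Submodule.subset_span ⟨_, rfl⟩) (Submodule.subset_span ⟨_, rfl⟩)
    | zero => simp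
    | add p q _ _ hp hq => rw [mul_add]; exact add_mem hp hq
    | smul c p _ hp => rw [mul_smul_comm]; exact Submodule.smul_mem _ c hp
  rw [eq_top_iff]
  rintro p -
  induction p using Polynomial.induction_on' with
  | add p q hp hq => exact add_mem hp hq
  | monomial n c =>
    rw [← mul_one c, ← smul_eq_mul, ← smul_monomial]
    refine Submodule.smul_mem _ c ?_
    rw [← X_pow_eq_monomial]
    induction n with
    | zero => rw [pow_zero, ← chebS_zero]; exact Submodule.subset_span ⟨0, rfl⟩
    | succ n ih => rw [pow_succ']; exact hX _ ih

lemma linearMap_ext_chebS {R M : Type*} [CommRing R] [AddCommGroup M] [Module R M]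
    {f g : R[X] →ₗ[R] M} (h : ∀ k, f (chebS R k) = g (chebS R k)) : f = g :=
  LinearMap.ext_on_range (span_chebS R) h

/-- Every polynomial is a constant plus a combination of Chebyshev polynomials of positive
degree. -/
lemma exists_eq_C_add (R : Type*) [CommRing R] (p : R[X]) :
    ∃ (c : R) (q : R[X]), q ∈ Submodule.span R (Set.range fun k => chebS R (k + 1)) ∧
      p = c • 1 + q := by
  have hp : p ∈ Submodule.span R (insert 1 (Set.range fun k => chebS R (k + 1))) := by
    have hset : Set.range (chebS R) ⊆ insert 1 (Set.range fun k => chebS R (k + 1)) := by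
      rintro _ ⟨k, rfl⟩
      cases k with
      | zero => exact Or.inl (chebS_zero R)
      | succ k => exact Or.inr ⟨k, rfl⟩
    exact Submodule.span_mono hset (by rw [span_chebS]; trivial)
  obtain ⟨c, q, hq, h⟩ := Submodule.mem_span_insert.1 hp
  exact ⟨c, q, hq, h⟩

lemma integral_cos_nat_mul (m : ℕ) :
    ∫ θ in (0 : ℝ)..Real.pi, Real.cos (m * θ) = if m = 0 then Real.pi else 0 := by
  split_ifs with h
  · simp [h]
  · have hm : (m : ℝ) ≠ 0 := by exact_mod_cast h
    rw [intervalIntegral.integral_comp_mul_left (fun x => Real.cos x) hm, integral_cos,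
      Real.sin_nat_mul_pi]
    simp

lemma eval_chebS_two_cos (k : ℕ) (θ : ℝ) :
    (chebS ℝ k).eval (2 * Real.cos θ) * Real.sin θ = Real.sin ((k + 1) * θ) := by
  have h := Chebyshev.U_real_cos θ k
  rw [← Chebyshev.S_comp_two_mul_X, eval_comp, eval_mul, eval_ofNat, eval_X] at h
  exact_mod_cast h

/-- Under `t = 2 cos θ` the integrand becomes `2 (cos (k θ) - cos ((k + 2) θ))` on `[0, π]`, whose
integral vanishes unless `k = 0`. -/
lemma integral_chebS (k : ℕ) :
    ∫ t in (-2 : ℝ)..2, (chebS ℝ k).eval t * √(4 - t ^ 2)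
      = if k = 0 then 2 * Real.pi else 0 := by
  have hsub := intervalIntegral.integral_comp_mul_deriv (a := 0) (b := Real.pi)
    (f := fun θ => 2 * Real.cos θ) (f' := fun θ => -(2 * Real.sin θ))
    (g := fun t => (chebS ℝ k).eval t * √(4 - t ^ 2))
    (fun θ _ => by simpa using (Real.hasDerivAt_cos θ).const_mul 2)
    (by fun_prop) (by fun_prop)
  simp only [Function.comp_apply, Real.cos_zero, Real.cos_pi, mul_one, mul_neg] at hsub
  rw [intervalIntegral.integral_symm, ← hsub, intervalIntegral.integral_neg, neg_neg]
  have hcongr : ∀ θ ∈ Set.uIcc 0 Real.pi,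
      (chebS ℝ k).eval (2 * Real.cos θ) * √(4 - (2 * Real.cos θ) ^ 2) * (2 * Real.sin θ)
        = 2 * (Real.cos ((k : ℕ) * θ) - Real.cos ((k + 2 : ℕ) * θ)) := by
    intro θ hθ
    rw [Set.uIcc_of_le Real.pi_nonneg] at hθ
    have hsqrt : √(4 - (2 * Real.cos θ) ^ 2) = 2 * Real.sin θ := by
      rw [show 4 - (2 * Real.cos θ) ^ 2 = (2 * Real.sin θ) ^ 2 by
        nlinarith [Real.sin_sq_add_cos_sq θ]]
      exact Real.sqrt_sq (by have := Real.sin_nonneg_of_mem_Icc hθ; linarith)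
    have h1 : Real.cos ((k : ℕ) * θ) - Real.cos ((k + 2 : ℕ) * θ)
        = 2 * (Real.sin ((k + 1) * θ) * Real.sin θ) := by
      have e1 : ((k : ℕ) : ℝ) * θ = (k + 1) * θ - θ := by ring
      have e2 : ((k + 2 : ℕ) : ℝ) * θ = (k + 1) * θ + θ := by push_cast; ring
      rw [e1, e2, Real.cos_sub, Real.cos_add]
      ring
    rw [hsqrt, h1, ← eval_chebS_two_cos]
    ring
  rw [intervalIntegral.integral_congr hcongr, intervalIntegral.integral_const_mul,
    intervalIntegral.integral_sub (Continuous.intervalIntegrable (by fun_prop) _ _)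
      (Continuous.intervalIntegrable (by fun_prop) _ _),
    integral_cos_nat_mul, integral_cos_nat_mul]
  split_ifs <;> simp_all

/-- Integration against the semicircle distribution. -/
def semicircleInt : ℝ[X] →ₗ[ℝ] ℝ where
  toFun q := (1 / (2 * Real.pi)) * ∫ t in (-2 : ℝ)..2, q.eval t * √(4 - t ^ 2)
  map_add' p q := by
    simp only [eval_add, add_mul]
    rw [intervalIntegral.integral_add (Continuous.intervalIntegrable (by fun_prop) _ _)
      (Continuous.intervalIntegrable (by fun_prop) _ _), mul_add]
  map_smul' c q := by
    simp only [eval_smul, smul_eq_mul, mul_assoc, RingHom.id_apply]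
    rw [intervalIntegral.integral_const_mul]
    ring

lemma semicircleInt_chebS (k : ℕ) : semicircleInt (chebS ℝ k) = if k = 0 then 1 else 0 := by
  change (1 / (2 * Real.pi)) * ∫ t in (-2 : ℝ)..2, (chebS ℝ k).eval t * √(4 - t ^ 2) = _
  rw [integral_chebS]
  have := Real.pi_ne_zero
  split_ifs
  · field_simp
  · simp

variable {A : Type*} [Ring A] [Algebra ℂ A]

/-- The distribution of an element, on real polynomials. -/
def realDistribution (φ : A →ₗ[ℂ] ℂ) (s : A) : ℝ[X] →ₗ[ℝ] ℂ where
  toFun q := φ (aeval s (q.map (algebraMap ℝ ℂ)))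
  map_add' p q := by simp
  map_smul' c q := by
    rw [Polynomial.map_smul, map_smul, map_smul]
    simp

lemma realDistribution_chebS (φ : A →ₗ[ℂ] ℂ) (s : A) (k : ℕ) :
    realDistribution φ s (chebS ℝ k) = φ (aeval s (chebS ℂ k)) := by
  change φ (aeval s ((chebS ℝ k).map (algebraMap ℝ ℂ))) = _
  rw [chebS, Chebyshev.map_S]
  rfl

lemma realDistribution_X_pow (φ : A →ₗ[ℂ] ℂ) (s : A) (k : ℕ) :
    realDistribution φ s (X ^ k) = φ (s ^ k) := by
  change φ (aeval s ((X ^ k : ℝ[X]).map (algebraMap ℝ ℂ))) = _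
  simp

lemma semicircleInt_X_pow (k : ℕ) :
    semicircleInt (X ^ k) = (1 / (2 * Real.pi)) * ∫ t in (-2 : ℝ)..2, t ^ k * √(4 - t ^ 2) := by
  change (1 / (2 * Real.pi)) * ∫ t in (-2 : ℝ)..2, (X ^ k : ℝ[X]).eval t * √(4 - t ^ 2) = _
  simp

/-- An element has semicircular moments if and only if the Chebyshev polynomials in it are
centred. -/
lemma moments_iff_chebS (φ : A →ₗ[ℂ] ℂ) (s : A) :
    (∀ p : ℕ, φ (s ^ p)
      = (((1 / (2 * Real.pi)) * ∫ t in (-2 : ℝ)..2, t ^ p * √(4 - t ^ 2) : ℝ) : ℂ)) ↔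
    ∀ k, φ (aeval s (chebS ℂ k)) = if k = 0 then 1 else 0 := by
  -- Both conditions say that two linear functionals on real polynomials agree, tested once on
  -- monomials and once on the Chebyshev spanning family.
  have hX : (∀ p : ℕ, φ (s ^ p)
      = (((1 / (2 * Real.pi)) * ∫ t in (-2 : ℝ)..2, t ^ p * √(4 - t ^ 2) : ℝ) : ℂ)) ↔
      realDistribution φ s = Complex.ofRealLI.toLinearMap ∘ₗ semicircleInt := by
    constructor
    · intro h
      refine Polynomial.lhom_ext' fun p => LinearMap.ext_ring ?_
      have := h p
      rw [← realDistribution_X_pow, ← semicircleInt_X_pow, X_pow_eq_monomial] at this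
      exact this
    · intro h p
      rw [← realDistribution_X_pow, ← semicircleInt_X_pow, h]
      rfl
  rw [hX]
  constructor
  · intro h k
    rw [← realDistribution_chebS, h]
    change ((semicircleInt (chebS ℝ k) : ℝ) : ℂ) = _
    rw [semicircleInt_chebS]
    split_ifs <;> simp
  · intro h
    refine linearMap_ext_chebS fun k => ?_
    rw [realDistribution_chebS, h]
    change _ = ((semicircleInt (chebS ℝ k) : ℝ) : ℂ)
    rw [semicircleInt_chebS]
    split_ifs <;> simp

end Semicircular

/-! ## A free pair of semicircular elements -/

section FockSpace

open Polynomial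

/-- The full Fock space over `ℂ²`. -/
abbrev Fock : Type := lp (fun _ : List (Fin 2) => ℂ) 2

/-- The canonical basis vector of a word. -/
def fockVec (w : List (Fin 2)) : Fock := lp.single 2 w 1

lemma inner_fockVec (w : List (Fin 2)) (f : Fock) : inner ℂ (fockVec w) f = f w := by
  rw [fockVec, lp.inner_single_left]
  simp

lemma fockVec_apply (v w : List (Fin 2)) : fockVec v w = if w = v then 1 else 0 := by
  rw [fockVec, lp.single_apply, Pi.single_apply]

lemma orthonormal_cons (i : Fin 2) : Orthonormal ℂ fun w => fockVec (i :: w) := by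
  rw [orthonormal_iff_ite]
  intro v w
  rw [inner_fockVec, fockVec_apply]
  simp

/-- The creation operator. -/
def creation (i : Fin 2) : Fock →L[ℂ] Fock :=
  (orthonormal_cons i).orthogonalFamily.linearIsometry.toContinuousLinearMap

lemma creation_fockVec (i : Fin 2) (w : List (Fin 2)) :
    creation i (fockVec w) = fockVec (i :: w) := by
  have := (orthonormal_cons i).orthogonalFamily.linearIsometry_apply_single (i := w) (1 : ℂ)
  refine Eq.trans this ?_
  simp

lemma annihilation_fockVec (i : Fin 2) (v : List (Fin 2)) :
    (creation i).adjoint (fockVec v) = if v.head? = some i then fockVec v.tail else 0 := by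
  ext u
  rw [← inner_fockVec, ContinuousLinearMap.adjoint_inner_right, creation_fockVec, inner_fockVec,
    fockVec_apply]
  cases v with
  | nil => simp
  | cons j v =>
    by_cases h : j = i
    · subst h; simp [fockVec_apply]
    · have h' : i ≠ j := fun h' => h h'.symm
      simp [h, h']

/-- The field operators. -/
def fieldOp (i : Fin 2) : Fock →L[ℂ] Fock := creation i + (creation i).adjoint

lemma star_fieldOp (i : Fin 2) : star (fieldOp i) = fieldOp i := by
  rw [fieldOp, star_add, ContinuousLinearMap.star_eq_adjoint, ContinuousLinearMap.star_eq_adjoint,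
    ContinuousLinearMap.adjoint_adjoint, add_comm]

lemma fieldOp_fockVec_of_ne {i : Fin 2} {w : List (Fin 2)} (h : w.head? ≠ some i) :
    fieldOp i (fockVec w) = fockVec (i :: w) := by
  rw [fieldOp, add_apply, creation_fockVec, annihilation_fockVec, if_neg h,
    add_zero]

lemma fieldOp_fockVec_cons (i : Fin 2) (w : List (Fin 2)) :
    fieldOp i (fockVec (i :: w)) = fockVec (i :: i :: w) + fockVec w := by
  rw [fieldOp, add_apply, creation_fockVec, annihilation_fockVec,
    if_pos (by simp), List.tail_cons]

/-- On a word beginning with `i`, the field operator adds one `i` or removes one; subtracting the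
shorter word, as the Chebyshev recurrence does, leaves pure creation. -/
lemma chebS_fieldOp {i : Fin 2} {w : List (Fin 2)} (h : w.head? ≠ some i) (k : ℕ) :
    aeval (fieldOp i) (chebS ℂ k) (fockVec w) = fockVec (List.replicate k i ++ w) := by
  induction k using Nat.twoStepInduction with
  | zero => simp [chebS_zero]
  | one => simp [chebS_one, fieldOp_fockVec_of_ne h]
  | more k h1 h2 =>
    rw [chebS_add_two, map_sub, map_mul, aeval_X, sub_apply,
      mul_apply_eq_comp, h1, h2, List.replicate_succ, List.cons_append,
      fieldOp_fockVec_cons, add_sub_cancel_right]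
    rfl

/-- The vacuum state. -/
def vacuum : (Fock →L[ℂ] Fock) →ₗ[ℂ] ℂ where
  toFun T := T (fockVec []) []
  map_add' _ _ := rfl
  map_smul' _ _ := rfl

lemma vacuum_apply (T : Fock →L[ℂ] Fock) : vacuum T = T (fockVec []) [] := rfl

lemma isState_vacuum : IsState vacuum := by
  have h : ∀ T : Fock →L[ℂ] Fock, vacuum (star T * T)
      = ((‖T (fockVec [])‖ ^ 2 : ℝ) : ℂ) := by
    intro T
    rw [vacuum_apply, ← inner_fockVec, mul_apply_eq_comp,
      ContinuousLinearMap.star_eq_adjoint, ContinuousLinearMap.adjoint_inner_right,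
      inner_self_eq_norm_sq_to_K]
    simp
  refine ⟨?_, fun T => ?_, fun T => ?_⟩
  · rw [vacuum_apply, one_apply_eq_self, fockVec_apply, if_pos rfl]
  · rw [h, Complex.ofReal_re]; positivity
  · rw [h, Complex.ofReal_im]

lemma vacuum_chebS_fieldOp (i : Fin 2) (k : ℕ) :
    vacuum (aeval (fieldOp i) (chebS ℂ k)) = if k = 0 then 1 else 0 := by
  rw [vacuum_apply, chebS_fieldOp (by simp), fockVec_apply]
  cases k <;> simp [List.replicate_succ]

lemma isSemicircular_fieldOp (i : Fin 2) : IsSemicircular vacuum (fieldOp i) :=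
  ⟨star_fieldOp i, (moments_iff_chebS vacuum (fieldOp i)).2 (vacuum_chebS_fieldOp i)⟩

/-- The span of the words which begin with a given letter. -/
def fockStart (i : Fin 2) : Submodule ℂ Fock :=
  Submodule.span ℂ (fockVec '' {w | w.head? = some i})

/-- Centring removes the constant term of the Chebyshev expansion, and each remaining term puts at
least one `i` in front of `w`. -/
lemma aeval_fieldOp_mem {i : Fin 2} {p : ℂ[X]} (hp : vacuum (aeval (fieldOp i) p) = 0)
    {w : List (Fin 2)} (hw : w.head? ≠ some i) :
    aeval (fieldOp i) p (fockVec w) ∈ fockStart i := by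
  obtain ⟨c, q, hq, rfl⟩ := exists_eq_C_add ℂ p
  have hq0 : vacuum (aeval (fieldOp i) q) = 0 := by
    clear hp
    induction hq using Submodule.span_induction with
    | mem q hq => obtain ⟨k, rfl⟩ := hq; rw [vacuum_chebS_fieldOp, if_neg k.succ_ne_zero]
    | zero => simp
    | add p q _ _ hp hq => rw [map_add, map_add, hp, hq, add_zero]
    | smul c q _ hq => rw [map_smul, map_smul, hq, smul_zero]
  have hc : c = 0 := by
    rw [map_add, map_add, hq0, map_smul, map_one, map_smul, isState_vacuum.map_one] at hp
    simpa using hp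
  rw [hc, zero_smul, zero_add]
  clear hq0 hp
  induction hq using Submodule.span_induction with
  | mem q hq =>
    obtain ⟨k, rfl⟩ := hq
    simp only
    rw [chebS_fieldOp hw]
    exact Submodule.subset_span ⟨_, by simp [List.replicate_succ], rfl⟩
  | zero => simp
  | add p q _ _ hp hq => rw [map_add]; exact add_mem hp hq
  | smul c q _ hq => rw [map_smul]; exact Submodule.smul_mem _ c hq

/-- Applied to the vacuum from the right, each centred factor meets words beginning with another
letter and prepends its own. The result is a combination of nonempty words and has no vacuum
component. -/
lemma isFree_fieldOp : IsFree vacuum fieldOp := by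
  have key : ∀ (k : ℕ) (i : Fin (k + 1) → Fin 2) (p : Fin (k + 1) → ℂ[X]),
      (∀ j : Fin k, i j.castSucc ≠ i j.succ) →
      (∀ j, vacuum (aeval (fieldOp (i j)) (p j)) = 0) →
      (List.ofFn fun j => aeval (fieldOp (i j)) (p j)).prod (fockVec []) ∈ fockStart (i 0) := by
    intro k
    induction k with
    | zero =>
      intro i p _ hp
      simpa using aeval_fieldOp_mem (hp 0) (w := []) (by simp)
    | succ k ih =>
      intro i p hi hp
      have hrest := ih (fun j => i j.succ) (fun j => p j.succ) (fun j => hi j.succ)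
        fun j => hp j.succ
      rw [List.ofFn_succ, List.prod_cons, mul_apply_eq_comp]
      generalize (List.ofFn fun j : Fin (k + 1) =>
        aeval (fieldOp (i j.succ)) (p j.succ)).prod (fockVec []) = x at hrest
      induction hrest using Submodule.span_induction with
      | mem x hx =>
        obtain ⟨w, hw, rfl⟩ := hx
        refine aeval_fieldOp_mem (hp 0) ?_
        rw [hw]
        exact fun h => hi 0 (Option.some.inj h).symm
      | zero => rw [map_zero]; exact zero_mem _
      | add x y _ _ hx hy => rw [map_add]; exact add_mem hx hy
      | smul c x _ hx => rw [map_smul]; exact Submodule.smul_mem _ c hx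
  intro k i p hi hp
  rw [vacuum_apply]
  have hmem := key k i p hi hp
  generalize (List.ofFn fun j => aeval (fieldOp (i j)) (p j)).prod (fockVec []) = x at hmem ⊢
  induction hmem using Submodule.span_induction with
  | mem x hx =>
    obtain ⟨w, hw, rfl⟩ := hx
    rw [fockVec_apply, if_neg]
    rintro rfl
    simp at hw
  | zero => rfl
  | add x y _ _ hx hy => rw [lp.coeFn_add, Pi.add_apply, hx, hy, add_zero]
  | smul c x _ hx => rw [lp.coeFn_smul, Pi.smul_apply, hx, smul_zero]

/-- For every parameter there is an elliptic element. -/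
theorem exists_isElliptic {r : ℝ} (h1 : -1 ≤ r) (h2 : r ≤ 1) :
    ∃ e : Fock →L[ℂ] Fock, IsElliptic vacuum r e := by
  refine ⟨_, h1, h2, fieldOp 0, fieldOp 1, isSemicircular_fieldOp 0, isSemicircular_fieldOp 1,
    ?_, rfl⟩
  have : ![fieldOp 0, fieldOp 1] = fieldOp := by
    ext i : 1
    fin_cases i <;> rfl
  rw [this]
  exact isFree_fieldOp

end FockSpace

/-! ## Moments of elliptic elements -/

section EllipticMoments

open Polynomial

section

variable {B : Type*} [Ring B]

/-- The Wick products of the letters of a word. -/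
def wick (s : Fin 2 → B) : List (Fin 2) → B
  | [] => 1
  | [i] => s i
  | i :: j :: w => s i * wick s (j :: w) - if i = j then wick s w else 0

lemma wick_cons_of_ne (s : Fin 2 → B) {i : Fin 2} {w : List (Fin 2)} (h : w.head? ≠ some i) :
    wick s (i :: w) = s i * wick s w := by
  cases w with
  | nil => simp [wick]
  | cons j w =>
    have hij : i ≠ j := fun hij => h (by simp [hij])
    rw [wick, if_neg hij, sub_zero]

lemma wick_cons_cons (s : Fin 2 → B) (i : Fin 2) (w : List (Fin 2)) :
    wick s (i :: i :: w) = s i * wick s (i :: w) - wick s w := by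
  rw [wick, if_pos rfl]

end

variable {B : Type*} [Ring B] [Algebra ℂ B]

/-- Within a run of equal letters the Wick recursion is the Chebyshev recurrence. -/
lemma wick_replicate (s : Fin 2 → B) {i : Fin 2} {w : List (Fin 2)} (h : w.head? ≠ some i)
    (k : ℕ) : wick s (List.replicate k i ++ w) = aeval (s i) (chebS ℂ k) * wick s w := by
  induction k using Nat.twoStepInduction with
  | zero => simp [chebS_zero]
  | one => simp [chebS_one, wick_cons_of_ne s h]
  | more k h1 h2 =>
    rw [chebS_add_two, map_sub, map_mul, aeval_X, sub_mul, mul_assoc, ← h1, ← h2,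
      List.replicate_succ, List.replicate_succ, List.cons_append, List.cons_append,
      wick_cons_cons]

lemma exists_eq_replicate_append (i : Fin 2) (w : List (Fin 2)) :
    ∃ (k : ℕ) (v : List (Fin 2)), w = List.replicate k i ++ v ∧ v.head? ≠ some i := by
  induction w with
  | nil => exact ⟨0, [], rfl, by simp⟩
  | cons j w ih =>
    by_cases h : j = i
    · obtain ⟨k, v, hw, hv⟩ := ih
      exact ⟨k + 1, v, by rw [h, hw, List.replicate_succ, List.cons_append], hv⟩
    · exact ⟨0, j :: w, rfl, by simpa using h⟩

/-- A Wick product is an alternating product of centred polynomials. -/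
lemma exists_alternating (φ : B →ₗ[ℂ] ℂ) (s : Fin 2 → B)
    (hs : ∀ i k, φ (aeval (s i) (chebS ℂ k)) = if k = 0 then 1 else 0) (w : List (Fin 2)) :
    ∃ L : List (Fin 2 × ℂ[X]), wick s w = (L.map fun x => aeval (s x.1) x.2).prod ∧
      L.IsChain (fun x y => x.1 ≠ y.1) ∧ (∀ x ∈ L, φ (aeval (s x.1) x.2) = 0) ∧
      L.head?.map Prod.fst = w.head? := by
  induction hn : w.length using Nat.strong_induction_on generalizing w with
  | _ n ih =>
  cases w with
  | nil => exact ⟨[], by simp [wick]⟩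
  | cons i w =>
    obtain ⟨k, v, rfl, hv⟩ := exists_eq_replicate_append i w
    obtain ⟨L, h1, h2, h3, h4⟩ := ih v.length (by simp at hn; omega) v rfl
    refine ⟨(i, chebS ℂ (k + 1)) :: L, ?_, ?_, ?_, by simp⟩
    · rw [← List.cons_append, ← List.replicate_succ, wick_replicate s hv, h1, List.map_cons,
        List.prod_cons]
    · rw [List.isChain_cons]
      refine ⟨fun y hy => ?_, h2⟩
      rintro rfl
      rw [← h4] at hv
      exact hv (by rw [Option.mem_def.1 hy]; rfl)
    · intro x hx
      rcases List.mem_cons.1 hx with rfl | hx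
      · rw [hs, if_neg k.succ_ne_zero]
      · exact h3 x hx

/-- Splitting a nonempty word into runs of equal letters gives an alternating product of centred
Chebyshev polynomials, which freeness annihilates. -/
lemma apply_wick {φ : B →ₗ[ℂ] ℂ} (hφ : φ 1 = 1) {s : Fin 2 → B}
    (hs : ∀ i k, φ (aeval (s i) (chebS ℂ k)) = if k = 0 then 1 else 0) (hfree : IsFree φ s)
    (w : List (Fin 2)) : φ (wick s w) = if w = [] then 1 else 0 := by
  obtain ⟨L, h1, h2, h3, h4⟩ := exists_alternating φ s hs w
  cases w with
  | nil => simpa [wick] using hφ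
  | cons i w =>
    cases L with
    | nil => simp at h4
    | cons x L =>
      rw [if_neg (by simp), h1]
      have := hfree L.length (fun j => ((x :: L).get j).1) (fun j => ((x :: L).get j).2)
        (fun j => List.isChain_iff_getElem.1 h2 j (by simp)) (fun j => h3 _ (List.get_mem _ _))
      have hL : (x :: L).map (fun x => aeval (s x.1) x.2)
          = List.ofFn fun j => aeval (s ((x :: L).get j).1) ((x :: L).get j).2 := by
        conv_lhs => rw [← List.ofFn_get (x :: L), List.map_ofFn]
        rfl
      rw [hL]
      exact this

/-- The linear combinations of Wick products. -/
def wickMap (s : Fin 2 → B) : (List (Fin 2) →₀ ℂ) →ₗ[ℂ] B := Finsupp.linearCombination ℂ (wick s)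

lemma wickMap_single (s : Fin 2 → B) (w : List (Fin 2)) :
    wickMap s (Finsupp.single w 1) = wick s w := by
  rw [wickMap, Finsupp.linearCombination_single, one_smul]

/-- The algebraic creation operator. -/
def prepend (i : Fin 2) : (List (Fin 2) →₀ ℂ) →ₗ[ℂ] (List (Fin 2) →₀ ℂ) :=
  Finsupp.lmapDomain ℂ ℂ (List.cons i)

lemma prepend_single (i : Fin 2) (w : List (Fin 2)) :
    prepend i (Finsupp.single w 1) = Finsupp.single (i :: w) 1 := by
  rw [prepend, Finsupp.lmapDomain_apply, Finsupp.mapDomain_single]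

/-- The algebraic annihilation operator. -/
def annihilate (i : Fin 2) : (List (Fin 2) →₀ ℂ) →ₗ[ℂ] (List (Fin 2) →₀ ℂ) :=
  Finsupp.linearCombination ℂ fun w => if w.head? = some i then Finsupp.single w.tail 1 else 0

lemma annihilate_single (i : Fin 2) (w : List (Fin 2)) :
    annihilate i (Finsupp.single w 1)
      = if w.head? = some i then Finsupp.single w.tail 1 else 0 := by
  rw [annihilate, Finsupp.linearCombination_single, one_smul]

lemma annihilate_prepend (i j : Fin 2) (f : List (Fin 2) →₀ ℂ) :
    annihilate i (prepend j f) = if i = j then f else 0 := by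
  have : annihilate i ∘ₗ prepend j = if i = j then LinearMap.id else 0 := by
    refine Finsupp.lhom_ext' fun w => LinearMap.ext_ring ?_
    change annihilate i (prepend j (Finsupp.single w 1)) = _
    rw [prepend_single, annihilate_single]
    by_cases h : i = j
    · subst h; simp
    · have h' : j ≠ i := fun h' => h h'.symm
      simp [h, h']
  have := LinearMap.congr_fun this f
  rw [LinearMap.comp_apply] at this
  rw [this]
  split_ifs <;> rfl

/-- This is the recursion defining `wick`, read as a formula for `s i * wick s w`: the field
operator relation, valid here in any algebra and without a state. -/
lemma mul_wickMap (s : Fin 2 → B) (i : Fin 2) (f : List (Fin 2) →₀ ℂ) :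
    s i * wickMap s f = wickMap s (prepend i f) + wickMap s (annihilate i f) := by
  have : LinearMap.mulLeft ℂ (s i) ∘ₗ wickMap s
      = wickMap s ∘ₗ prepend i + wickMap s ∘ₗ annihilate i := by
    refine Finsupp.lhom_ext' fun w => LinearMap.ext_ring ?_
    change s i * wickMap s (Finsupp.single w 1) = wickMap s (prepend i (Finsupp.single w 1))
      + wickMap s (annihilate i (Finsupp.single w 1))
    rw [prepend_single, annihilate_single, wickMap_single, wickMap_single]
    cases w with
    | nil => simp [wick]
    | cons j w =>
      by_cases h : i = j
      · subst h
        rw [if_pos (by simp), List.tail_cons, wickMap_single, wick_cons_cons, sub_add_cancel]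
      · have h' : j ≠ i := fun h' => h h'.symm
        rw [if_neg (by simpa using h'), map_zero, add_zero, wick_cons_of_ne s (w := j :: w) (by simpa using h')]
  exact LinearMap.congr_fun this f

lemma apply_wickMap {φ : B →ₗ[ℂ] ℂ} {s : Fin 2 → B}
    (h : ∀ w, φ (wick s w) = if w = [] then 1 else 0) (f : List (Fin 2) →₀ ℂ) :
    φ (wickMap s f) = f [] := by
  have : φ ∘ₗ wickMap s = Finsupp.lapply [] := by
    refine Finsupp.lhom_ext' fun w => LinearMap.ext_ring ?_
    change φ (wickMap s (Finsupp.single w 1)) = Finsupp.single w 1 []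
    rw [wickMap_single, h, Finsupp.single_apply]
  exact LinearMap.congr_fun this f

variable {K : Type*}

/-- The tensor product of the vectors `u x`, for the letters `x` of a word. -/
def tensorVec (u : K → Fin 2 → ℂ) : List K → (List (Fin 2) →₀ ℂ)
  | [] => Finsupp.single [] 1
  | x :: l => ∑ i, u x i • prepend i (tensorVec u l)

lemma tensorVec_nil_apply (u : K → Fin 2 → ℂ) (l : List K) :
    tensorVec u l [] = if l = [] then 1 else 0 := by
  cases l with
  | nil => simp [tensorVec]
  | cons x l =>
    have : ∀ i, prepend i (tensorVec u l) [] = 0 := fun i => by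
      rw [prepend, Finsupp.lmapDomain_apply]
      exact Finsupp.mapDomain_of_notMem_range _ _ (by simp)
    simp [tensorVec, this]

lemma mul_tensorVec_nil (s : Fin 2 → B) (u : K → Fin 2 → ℂ) (x : K) :
    (∑ i, u x i • s i) * wickMap s (tensorVec u []) = wickMap s (tensorVec u [x]) := by
  rw [tensorVec, tensorVec, tensorVec, Finset.sum_mul, map_sum]
  refine Finset.sum_congr rfl fun i _ => ?_
  rw [smul_mul_assoc, mul_wickMap, annihilate_single, map_smul]
  simp

/-- Annihilation contracts the new letter with the first letter of the tensor by the bilinear form;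
the two terms match the two branches of `wickSum`. -/
lemma mul_tensorVec_cons (s : Fin 2 → B) (u : K → Fin 2 → ℂ) (x y : K) (l : List K) :
    (∑ i, u x i • s i) * wickMap s (tensorVec u (y :: l))
      = wickMap s (tensorVec u (x :: y :: l))
        + (∑ i, u x i * u y i) • wickMap s (tensorVec u l) := by
  have h : ∀ i, annihilate i (tensorVec u (y :: l)) = u y i • tensorVec u l := by
    intro i
    rw [tensorVec, map_sum]
    simp [annihilate_prepend]
  have hx : tensorVec u (x :: y :: l) = ∑ i, u x i • prepend i (tensorVec u (y :: l)) := rfl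
  rw [hx, Finset.sum_mul, map_sum, Finset.sum_smul, ← Finset.sum_add_distrib]
  refine Finset.sum_congr rfl fun i _ => ?_
  rw [smul_mul_assoc, mul_wickMap, h, map_smul, map_smul, smul_add, mul_smul]

/-- The joint moments of linear combinations of free semicircular elements. -/
theorem apply_prod_eq_wickSum {φ : B →ₗ[ℂ] ℂ} {s : Fin 2 → B}
    (h : ∀ w, φ (wick s w) = if w = [] then 1 else 0) (u : K → Fin 2 → ℂ) (l S : List K) :
    φ ((l.reverse.map fun x => ∑ i, u x i • s i).prod * wickMap s (tensorVec u S))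
      = wickSum (fun x y => ∑ i, u x i * u y i) l S := by
  induction l generalizing S with
  | nil =>
    rw [List.reverse_nil, List.map_nil, List.prod_nil, one_mul, apply_wickMap h,
      tensorVec_nil_apply]
    cases S <;> simp [wickSum]
  | cons x l ih =>
    rw [List.reverse_cons, List.map_append, List.prod_append, List.map_singleton,
      List.prod_singleton, mul_assoc]
    cases S with
    | nil => rw [mul_tensorVec_nil, ih, wickSum]
    | cons y S =>
      rw [mul_tensorVec_cons, mul_add, map_add, ih, mul_smul_comm, map_smul, ih, wickSum,
        smul_eq_mul]

/-- The moments of an elliptic element. -/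
theorem IsElliptic.apply_starWord [StarRing B] [StarModule ℂ B] {φ : B →ₗ[ℂ] ℂ} (hφ : IsState φ)
    {r : ℝ} {e : B} (he : IsElliptic φ r e) {p : ℕ} (ε : Fin p → Bool) :
    φ (starWord e ε)
      = wickSum (fun x y => if x = y then (r : ℂ) else 1) (List.ofFn ε).reverse [] := by
  obtain ⟨h1, h2, s₁, s₂, hs₁, hs₂, hfree, rfl⟩ := he
  set α : ℂ := ((√((1 + r) / 2) : ℝ) : ℂ) with hα
  set β : ℂ := ((√((1 - r) / 2) : ℝ) : ℂ) with hβ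
  have hα2 : α * α = (1 + r) / 2 := by
    rw [hα, ← Complex.ofReal_mul, Real.mul_self_sqrt (by linarith)]
    push_cast
    rfl
  have hβ2 : β * β = (1 - r) / 2 := by
    rw [hβ, ← Complex.ofReal_mul, Real.mul_self_sqrt (by linarith)]
    push_cast
    rfl
  have hs : ∀ i k, φ (aeval (![s₁, s₂] i) (chebS ℂ k)) = if k = 0 then 1 else 0 := by
    intro i
    fin_cases i
    · exact (moments_iff_chebS φ s₁).1 hs₁.moment
    · exact (moments_iff_chebS φ s₂).1 hs₂.moment
  -- Coordinates of the element and its adjoint in the two semicirculars; the adjoint flips the sign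
  -- of the imaginary one. The bilinear, not sesquilinear, pairing gives `α² - β² = r` for equal
  -- letters and `α² + β² = 1` for different ones.
  set u : Bool → Fin 2 → ℂ := fun b => ![α, if b then -(Complex.I * β) else Complex.I * β] with hu
  have hI : Complex.I * β * (Complex.I * β) = -((1 - r) / 2) := by
    rw [← hβ2, mul_mul_mul_comm, Complex.I_mul_I]; ring
  have hcov : (fun x y : Bool => ∑ i, u x i * u y i) = fun x y => if x = y then (r : ℂ) else 1 := by
    ext x y
    rw [Fin.sum_univ_two]
    cases x <;> cases y <;> simp [hu, hα2, hI] <;> ring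
  have hstar : star (α • s₁ + (Complex.I * β) • s₂) = α • s₁ + (-(Complex.I * β)) • s₂ := by
    rw [star_add, star_smul, star_smul, hs₁.selfAdjoint, hs₂.selfAdjoint]
    congr 2
    · exact Complex.conj_ofReal _
    · rw [star_mul', Complex.star_def, Complex.conj_I, hβ, Complex.conj_ofReal]
      ring
  have hword : starWord (α • s₁ + (Complex.I * β) • s₂) ε
      = ((List.ofFn ε).reverse.reverse.map fun x => ∑ i, u x i • ![s₁, s₂] i).prod := by
    rw [List.reverse_reverse, List.map_ofFn, starWord, hstar]
    congr 2
    ext j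
    rw [Function.comp_apply, Fin.sum_univ_two]
    cases ε j <;> simp [hu]
  have := apply_prod_eq_wickSum (apply_wick hφ.map_one hs hfree) u (List.ofFn ε).reverse []
  rwa [hcov, tensorVec, wickMap_single, wick, mul_one, ← hword] at this

end EllipticMoments

/-! ### Convergence to elliptic elements for constant correlations -/

section Main

variable {Ω : ℕ → Type*} [∀ n, MeasurableSpace (Ω n)] {P : ∀ n, Measure (Ω n)}
  {a : ∀ n, Ω n → Matrix (Fin n) (Fin n) ℝ} {ρ : ℕ → ℕ → ℝ}

/-- A sequence of elliptic matrices with constant correlation converges to every elliptic element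
with this parameter. -/
theorem IsGeneralisedElliptic.convergesInStarDist_of_isElliptic
    [∀ n, IsProbabilityMeasure (P n)] (h : IsGeneralisedElliptic P a ρ) {r : ℝ}
    (hr : ∀ n i, 1 ≤ i → ρ n i = r) {B : Type*} [Ring B] [StarRing B] [Algebra ℂ B]
    [StarModule ℂ B] {ψ : B →ₗ[ℂ] ℂ} (hψ : IsState ψ) {e : B} (he : IsElliptic ψ r e) :
    ConvergesInStarDist P (fun n => scaled (a n)) ψ e := by
  intro p ε
  rw [he.apply_starWord hψ]
  exact h.tendsto_wickSum hr ε

lemma IsGeneralisedElliptic.abs_le_one_of_const (h : IsGeneralisedElliptic P a ρ) {r : ℝ}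
    (hr : ∀ n i, 1 ≤ i → ρ n i = r) : |r| ≤ 1 := by
  -- Size `2` is the smallest with an off-diagonal entry, so `r` is a genuine correlation there.
  rw [← hr 2 1 le_rfl]
  exact h.abs_corr_le_one le_rfl one_lt_two

end Main

end EllipticMatrices

end

theorem theorem3p1 {Ω : ℕ → Type*} [∀ n, MeasurableSpace (Ω n)] (P : ∀ n, Measure (Ω n))
    [∀ n, IsProbabilityMeasure (P n)] (a : ∀ n, Ω n → Matrix (Fin n) (Fin n) ℝ)
    (ρ : ℕ → ℕ → ℝ) (h : EllipticMatrices.IsGeneralisedElliptic P a ρ) :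
    (EllipticMatrices.LimitCondition ρ →
      ∃ (A : Type) (_ : Ring A) (_ : StarRing A) (_ : Algebra ℂ A) (_ : StarModule ℂ A)
        (φ : A →ₗ[ℂ] ℂ) (x : A), EllipticMatrices.IsState φ ∧
        EllipticMatrices.ConvergesInStarDist P
          (fun n => EllipticMatrices.scaled (a n)) φ x) ∧
    ∀ r : ℝ, (∀ n i, 1 ≤ i → ρ n i = r) →
      EllipticMatrices.LimitCondition ρ ∧
      (∃ (A : Type) (_ : Ring A) (_ : StarRing A) (_ : Algebra ℂ A) (_ : StarModule ℂ A)
        (φ : A →ₗ[ℂ] ℂ) (e : A), EllipticMatrices.IsState φ ∧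
        EllipticMatrices.IsElliptic φ r e ∧
        EllipticMatrices.ConvergesInStarDist P
          (fun n => EllipticMatrices.scaled (a n)) φ e) ∧
      (∀ (B : Type*) [Ring B] [StarRing B] [Algebra ℂ B] [StarModule ℂ B]
        (ψ : B →ₗ[ℂ] ℂ) (e : B), EllipticMatrices.IsState ψ →
        EllipticMatrices.IsElliptic ψ r e →
        EllipticMatrices.ConvergesInStarDist P
          (fun n => EllipticMatrices.scaled (a n)) ψ e) := by
  refine ⟨fun hL => ?_, fun r hr => ⟨h.limitCondition hr, ?_, ?_⟩⟩
  · obtain ⟨φ, x, hφ, hx⟩ := h.exists_limit_state hL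
    exact ⟨EllipticMatrices.StarPoly, inferInstance, inferInstance, inferInstance, inferInstance,
      φ, x, hφ, hx⟩
  · obtain ⟨h1, h2⟩ := abs_le.1 (h.abs_le_one_of_const hr)
    obtain ⟨e, he⟩ := EllipticMatrices.exists_isElliptic h1 h2
    exact ⟨EllipticMatrices.Fock →L[ℂ] EllipticMatrices.Fock, inferInstance, inferInstance,
      inferInstance, inferInstance, EllipticMatrices.vacuum, e, EllipticMatrices.isState_vacuum, he,
      h.convergesInStarDist_of_isElliptic hr EllipticMatrices.isState_vacuum he⟩
  · intro B _ _ _ _ ψ e hψ he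
    exact h.convergesInStarDist_of_isElliptic hr hψ he
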